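/- Let $\ell>0$, let $\mathbb{T}^d=\mathbb{R}^d/2\pi\ell\mathbb{Z}^d$, and consider the weakly nonlinear complex Ginzburg–Landau equation $$u_t+i\Delta u=\epsilon\big[\mu(-1)^{m-1}\Delta^m u+b|u|^{2p}u+ic|u|^{2q}u\big],\qquad u=u(t,x)\in\mathbb{C},\ x\in\mathbb{T}^d. \tag{1}$$ For $s\ge 0$ let $H^s$ be the Sobolev space of complex-valued functions on $\mathbb{T}^d$ with norm $\|u\|_s^2=\langle(-\Delta)^s u,u\rangle+\langle u,u\rangle=\sum_{k\in\mathbb{Z}^d}(\lambda_k^{s}+1)|u_k|^2$, where $u_k$ are the Fourier coefficients of $u$ with respect to the characters $e^{ik\cdot x/\ell}$ (for the normalised Lebesgue measure) and $\lambda_k=|k|^2/\ell^2$. A solution of (1) on $[0,S]$ is a function $u\in C([0,S],H^s)$, $s>d/2$, that satisfies (1) in the sense of distributions. Let $\mu>0$, $b\le 0$ and $c\le 0$. Then for all $p,q,d\in\mathbb{N}=\{0,1,2,\dots\}$ there is an integer $m\ge 1$ such that the following holds. There exist $s>d/2$, $T>0$ and a nondecreasing function $C:\mathbb{R}\to\mathbb{R}$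 such that for every $\epsilon>0$ and every $u_0\in H^s$, equation (1) has a unique solution $u\in C([0,\epsilon^{-1}T],H^s)$ with $u(0)=u_0$, and $$\|u(t)\|_s\le C(\|u_0\|_s)\qquad\text{for all } t\in[0,\epsilon^{-1}T].$$ In particular $s$, $T$ and $C$ do not depend on $\epsilon$, and $s$ and $T$ do not depend on $u_0$. -/

import Mathlib

open MeasureTheory Filter Topology

noncomputable section

namespace CGL

/-- The normalised Lebesgue (Haar) measure on the `d`-dimensional torus.  The torus
`ℝᵈ / 2πℓℤᵈ` is identified with the unit torus `ℝᵈ / ℤᵈ` through `x = 2πℓ y`. -/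
abbrev torusMeasure (d : ℕ) : Measure (UnitAddTorus (Fin d)) :=
  Measure.pi fun _ => AddCircle.haarAddCircle

/-- Complex valued `L²` functions on the torus. -/
abbrev L2 (d : ℕ) : Type := Lp ℂ 2 (torusMeasure d)

/-- The Fourier coefficients of a function `w` on `ℝᵈ / 2πℓℤᵈ` with respect to the characters
`x ↦ exp (i k·x / ℓ)`, which in the variable `y = x / (2πℓ)` are `y ↦ exp (2πi k·y)`. -/
def coeff {d : ℕ} (w : UnitAddTorus (Fin d) → ℂ) (k : Fin d → ℤ) : ℂ :=
  UnitAddTorus.mFourierCoeff w k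

/-- The eigenvalue `λ_k = |k|² / ℓ²` of `-Δ` on `ℝᵈ / 2πℓℤᵈ` for the character
`exp (i k·x / ℓ)`. -/
def eig {d : ℕ} (ℓ : ℝ) (k : Fin d → ℤ) : ℝ :=
  (∑ j, (k j : ℝ) ^ 2) / ℓ ^ 2

/-- Membership in the Sobolev space `H^s` (here `s ≥ 0`, so that `H^s ⊆ L²`):
`∑_k (λ_k^s + 1) |w_k|² < ∞`. -/
def MemH {d : ℕ} (ℓ s : ℝ) (w : L2 d) : Prop :=
  Summable fun k : Fin d → ℤ => (eig ℓ k ^ s + 1) * ‖coeff w k‖ ^ 2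

/-- The norm of `H^s`: `‖w‖_s² = ⟨(-Δ)^s w, w⟩ + ⟨w, w⟩ = ∑_k (λ_k^s + 1) |w_k|²`. -/
def normH {d : ℕ} (ℓ s : ℝ) (w : L2 d) : ℝ :=
  Real.sqrt (∑' k : Fin d → ℤ, (eig ℓ k ^ s + 1) * ‖coeff w k‖ ^ 2)

/-- `u ∈ C(J, H^s)`. -/
def ContinuousInH {d : ℕ} (ℓ s : ℝ) (J : Set ℝ) (u : ℝ → L2 d) : Prop :=
  (∀ t ∈ J, MemH ℓ s (u t)) ∧
    ∀ t ∈ J, Tendsto (fun r => normH ℓ s (u r - u t)) (𝓝[J] t) (𝓝 0)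

/-- The power nonlinearity `|w|^{2n} w`, formed pointwise. -/
def powNL {d : ℕ} (n : ℕ) (w : L2 d) : UnitAddTorus (Fin d) → ℂ :=
  fun y => (‖w y‖ : ℂ) ^ (2 * n) * w y

/-- The parameters of the equation
`u_t + iΔu = ε [μ (-1)^{m-1} Δ^m u + b |u|^{2p} u + i c |u|^{2q} u]`
on the torus `ℝᵈ / 2πℓℤᵈ`, without the small parameter `ε`. -/
structure Params where
  d : ℕ
  ℓ : ℝ
  m : ℕ
  p : ℕ
  q : ℕ
  μ : ℝ
  b : ℝ
  c : ℝ

/-- The `k`-th Fourier coefficient of the right-hand side of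
`u_t = -iΔu + ε [μ (-1)^{m-1} Δ^m u + b |u|^{2p} u + i c |u|^{2q} u]`.
The Laplacian acts on periodic distributions as multiplication of the `k`-th Fourier coefficient
by `-λ_k`.  The exponent `m + 1` has the parity of `m - 1`. -/
def rhsCoeff (P : Params) (ε : ℝ) (w : L2 P.d) (k : Fin P.d → ℤ) : ℂ :=
  -Complex.I * ((-eig P.ℓ k : ℝ) : ℂ) * coeff w k +
    (ε : ℂ) * ((P.μ : ℂ) * (-1) ^ (P.m + 1) * ((-eig P.ℓ k : ℝ) : ℂ) ^ P.m * coeff w k +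
      (P.b : ℂ) * coeff (powNL P.p w) k +
      Complex.I * (P.c : ℂ) * coeff (powNL P.q w) k)

/-- `u ∈ C([0, S], H^s)` solves the equation on `[0, S]` with initial datum `u₀`.  The equation
holds in the sense of distributions on the torus, i.e. after pairing with each character. -/
structure IsSolution (P : Params) (ε s S : ℝ) (u₀ : L2 P.d) (u : ℝ → L2 P.d) : Prop where
  continuousInH : ContinuousInH P.ℓ s (Set.Icc 0 S) u
  initial : u 0 = u₀
  equation : ∀ k : Fin P.d → ℤ, ∀ t ∈ Set.Icc 0 S,
    HasDerivWithinAt (fun r => coeff (u r) k) (rhsCoeff P ε (u t) k) (Set.Icc 0 S) t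

/-- There are `s > d/2` and `T > 0` such that for every initial datum `u₀ ∈ H^s` and every `ε > 0`
the equation has a unique solution in `C([0, ε⁻¹T], H^s)`, and its `H^s` norm is bounded on
`[0, ε⁻¹T]` by a (nondecreasing) function of `‖u₀‖_s` that does not depend on `ε`. -/
def UniformlyWellPosed (P : Params) : Prop :=
  ∃ s : ℝ, (P.d : ℝ) / 2 < s ∧ ∃ T : ℝ, 0 < T ∧ ∃ C : ℝ → ℝ, Monotone C ∧
    ∀ ε : ℝ, 0 < ε → ∀ u₀ : L2 P.d, MemH P.ℓ s u₀ →
      ∃ u : ℝ → L2 P.d, IsSolution P ε s (ε⁻¹ * T) u₀ u ∧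
        (∀ v : ℝ → L2 P.d, IsSolution P ε s (ε⁻¹ * T) u₀ v →
          Set.EqOn v u (Set.Icc 0 (ε⁻¹ * T))) ∧
        ∀ t ∈ Set.Icc 0 (ε⁻¹ * T), normH P.ℓ s (u t) ≤ C (normH P.ℓ s u₀)

end CGL

end

/-! The order `m` is taken so large that a truncation of the nonlinearity is never felt. Put `n = p
+ q`, `ρ = ‖u₀‖_m`, `κ = (|b| + |c|)² / (2μ)`, `W = ∑ weight`, and cut the moduli in `|u|^{2p}`,
`|u|^{2q}` at a level `R ≥ 1`. The truncated equation is a diagonal dissipative system in Fourier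
coordinates with a Lipschitz perturbation on `L²`, so it is globally solvable by contraction
(`exists_solvesDiagonal`). Since `b ≤ 0` and the `ic` term is skew, the `L²` norm does not grow
(`norm_le_of_solvesDiagonal`). Dissipation `εμλ_k^m` against a forcing of size `ε` yields, while `εS
≤ 1`, the bound `‖u(t)‖_m² ≤ ρ²(1+κ)R^{4n}`, free of `ε` (`exists_majorant`). Interpolation with
`|u_k| ≤ ρ` gives `|u_k|^{8n+2}(λ_k^m + 1) ≤ ρ^{8n+2}(1+κ)R^{4n}`. For `m = 2(4n+1)(d+1)`, the root
of order `8n+2` gives `|u_k| ≤ ρ(1+κ)R^{1/2} weight_k`, with a summable weight (`le_mul_weight`).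
Hence `sup |u| ≤ ρ(1+κ)W R^{1/2}`, sublinear in `R`, and `R = (1 + ρ(1+κ)W)²` makes the truncation
inactive (`exists_isSolution`). Thus `s = m` and `T = 1` are admissible. For uniqueness, `H^m`
solutions are bounded functions, so any two solve the equation truncated at a common level, where
Gronwall in `L²` applies. -/

noncomputable section

open scoped NNReal BoundedContinuousFunction

/-! ### Diagonal evolution equations in a Hilbert basis: semigroup and Duhamel fixed point. -/

namespace HilbertBasis

variable {ι E : Type*} [NormedAddCommGroup E] [InnerProductSpace ℂ E]

theorem hasSum_norm_sq_repr (e : HilbertBasis ι ℂ E) (f : E) :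
    HasSum (fun i => ‖e.repr f i‖ ^ 2) (‖f‖ ^ 2) := by
  have h := lp.hasSum_inner (𝕜 := ℂ) (e.repr f) (e.repr f)
  have h2 := (Complex.hasSum_re h)
  rw [LinearIsometryEquiv.inner_map_map] at h2
  have h3 : (inner ℂ f f).re = ‖f‖ ^ 2 := inner_self_eq_norm_sq (𝕜 := ℂ) f
  rw [h3] at h2
  refine h2.congr_fun fun i => ?_
  exact (inner_self_eq_norm_sq (𝕜 := ℂ) (e.repr f i)).symm

theorem norm_repr_le (e : HilbertBasis ι ℂ E) (f : E) (i : ι) : ‖e.repr f i‖ ≤ ‖f‖ := by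
  have := le_hasSum (e.hasSum_norm_sq_repr f) i fun _ _ => sq_nonneg _
  exact le_of_sq_le_sq this (norm_nonneg _)

/-- The coordinate functional of a Hilbert basis. -/
def coordCLM (e : HilbertBasis ι ℂ E) (i : ι) : E →L[ℂ] ℂ :=
  LinearMap.mkContinuous
    { toFun := fun f => e.repr f i
      map_add' := fun f g => by simp
      map_smul' := fun c f => by simp } 1 fun f => by simpa using e.norm_repr_le f i

theorem coordCLM_apply (e : HilbertBasis ι ℂ E) (i : ι) (f : E) : e.coordCLM i f = e.repr f i := rfl

theorem norm_le_mul_norm_of_repr (e : HilbertBasis ι ℂ E) {f g : E} {c : ℝ} (hc : 0 ≤ c)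
    (h : ∀ i, ‖e.repr f i‖ ≤ c * ‖e.repr g i‖) : ‖f‖ ≤ c * ‖g‖ := by
  refine le_of_sq_le_sq ?_ (by positivity)
  rw [mul_pow]
  refine hasSum_le (fun i => ?_) (e.hasSum_norm_sq_repr f)
    ((e.hasSum_norm_sq_repr g).mul_left (c ^ 2))
  rw [← mul_pow]
  exact pow_le_pow_left₀ (norm_nonneg _) (h i) 2

theorem ext_repr (e : HilbertBasis ι ℂ E) {f g : E} (h : ∀ i, e.repr f i = e.repr g i) :
    f = g := by
  apply e.repr.injective
  ext i
  exact h i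

/-- A diagonal semigroup `exp (t a)` with `Re a ≤ -κ`, frozen at negative times. -/
theorem exists_diagonal_semigroup (e : HilbertBasis ι ℂ E) {κ : ℝ} {a : ι → ℂ}
    (ha : ∀ i, (a i).re ≤ -κ) (hκ : 0 ≤ κ) :
    ∃ S : ℝ → E → E,
      (∀ t f i, e.repr (S t f) i = Complex.exp (a i * (max t 0 : ℝ)) * e.repr f i) ∧
      (∀ t f g, ‖S t f - S t g‖ ≤ Real.exp (-κ * max t 0) * ‖f - g‖) ∧
      Continuous (Function.uncurry S) := by
  have hexp : ∀ i t, ‖Complex.exp (a i * (max t 0 : ℝ))‖ ≤ Real.exp (-κ * max t 0) := by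
    intro i t
    rw [Complex.norm_exp]
    simp only [Complex.mul_re, Complex.ofReal_re, Complex.ofReal_im, mul_zero, sub_zero]
    exact Real.exp_le_exp.2 (mul_le_mul_of_nonneg_right (ha i) (le_max_right _ _))
  have hexp1 : ∀ i t, ‖Complex.exp (a i * (max t 0 : ℝ))‖ ≤ 1 := fun i t =>
    (hexp i t).trans (Real.exp_le_one_iff.2 (by
      have := mul_nonneg hκ (le_max_right t 0); linarith))
  have hmem : ∀ t f, Memℓp (fun i => Complex.exp (a i * (max t 0 : ℝ)) * e.repr f i) 2 := by
    intro t f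
    refine memℓp_gen ?_
    have hs := (e.hasSum_norm_sq_repr f).summable
    simp only [ENNReal.toReal_ofNat, Real.rpow_ofNat]
    refine hs.of_nonneg_of_le (fun i => by positivity) fun i => ?_
    rw [norm_mul]
    exact pow_le_pow_left₀ (by positivity)
      (mul_le_of_le_one_left (norm_nonneg _) (hexp1 i t)) 2
  have hrepr : ∀ t f i, e.repr (e.repr.symm ⟨_, hmem t f⟩) i =
      Complex.exp (a i * (max t 0 : ℝ)) * e.repr f i := by
    intro t f i
    rw [LinearIsometryEquiv.apply_symm_apply]
  have hlip : ∀ t f g, ‖e.repr.symm ⟨_, hmem t f⟩ - e.repr.symm ⟨_, hmem t g⟩‖ ≤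
      Real.exp (-κ * max t 0) * ‖f - g‖ := by
    intro t f g
    refine e.norm_le_mul_norm_of_repr (Real.exp_pos _).le fun i => ?_
    rw [map_sub, map_sub, lp.coeFn_sub, lp.coeFn_sub, Pi.sub_apply, Pi.sub_apply, hrepr, hrepr,
      ← mul_sub, norm_mul]
    exact mul_le_mul_of_nonneg_right (hexp i t) (norm_nonneg _)
  refine ⟨fun t f => e.repr.symm ⟨_, hmem t f⟩, hrepr, hlip, ?_⟩
  -- A Lipschitz constant in `f` uniform in time reduces joint continuity to continuity in time,
  -- which is dominated convergence over the coordinates.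
  refine continuous_prod_of_continuous_lipschitzWith' _ 1 (fun t => ?_) fun f => ?_
  · refine LipschitzWith.of_dist_le_mul fun f g => ?_
    rw [dist_eq_norm, dist_eq_norm]
    refine (hlip t f g).trans (mul_le_mul_of_nonneg_right ?_ (norm_nonneg _))
    exact Real.exp_le_one_iff.2 (by have := mul_nonneg hκ (le_max_right t 0); linarith)
  · rw [continuous_iff_continuousAt]
    intro t₀
    rw [ContinuousAt, tendsto_iff_norm_sub_tendsto_zero]
    have key : Tendsto (fun t => ∑' i, ‖e.repr (e.repr.symm ⟨_, hmem t f⟩ -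
        e.repr.symm ⟨_, hmem t₀ f⟩) i‖ ^ 2) (𝓝 t₀) (𝓝 (∑' _ : ι, (0 : ℝ))) := by
      refine tendsto_tsum_of_dominated_convergence
        (bound := fun i => 4 * ‖e.repr f i‖ ^ 2)
        ((e.hasSum_norm_sq_repr f).summable.mul_left 4) (fun i => ?_)
        (Eventually.of_forall fun t i => ?_)
      · have : Continuous fun t : ℝ => ‖Complex.exp (a i * (max t 0 : ℝ)) * e.repr f i -
            Complex.exp (a i * (max t₀ 0 : ℝ)) * e.repr f i‖ ^ 2 := by fun_prop
        have h := this.tendsto t₀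
        simp only [sub_self, norm_zero, ne_eq, OfNat.ofNat_ne_zero, not_false_eq_true,
          zero_pow] at h
        refine h.congr fun t => ?_
        rw [map_sub, lp.coeFn_sub, Pi.sub_apply, hrepr, hrepr]
      · rw [map_sub, lp.coeFn_sub, Pi.sub_apply, hrepr, hrepr, ← sub_mul, norm_mul,
          Real.norm_of_nonneg (by positivity), mul_pow]
        refine mul_le_mul_of_nonneg_right ?_ (by positivity)
        have h2 : ‖Complex.exp (a i * (max t 0 : ℝ)) - Complex.exp (a i * (max t₀ 0 : ℝ))‖ ≤ 2 :=
          (norm_sub_le _ _).trans (by linarith [hexp1 i t, hexp1 i t₀])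
        nlinarith [norm_nonneg
          (Complex.exp (a i * (max t 0 : ℝ)) - Complex.exp (a i * (max t₀ 0 : ℝ)))]
    rw [tsum_zero] at key
    have := key.congr fun t => (e.hasSum_norm_sq_repr _).tsum_eq
    have h2 := this.sqrt
    simpa using h2

end HilbertBasis

/-- The kernel `exp (-κ (t - r))` has mass at most `1/κ`. Uniformity in `t` lets the Duhamel
operator act on bounded functions on the whole line. -/
theorem norm_integral_le_of_exp_decay {E : Type*} [NormedAddCommGroup E] [NormedSpace ℝ E]
    {f : ℝ → E} {κ M t : ℝ} (hκ : 0 < κ) (hM : 0 ≤ M)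
    (hf : ∀ r ∈ Set.Ioc 0 (max t 0), ‖f r‖ ≤ Real.exp (-κ * max (t - r) 0) * M) :
    ‖∫ r in (0 : ℝ)..max t 0, f r‖ ≤ M / κ := by
  rcases le_total t 0 with ht | ht
  · rw [max_eq_right ht]
    simp only [intervalIntegral.integral_same, norm_zero]
    positivity
  rw [max_eq_left ht] at hf ⊢
  have hcont : Continuous fun r : ℝ => Real.exp (-κ * (t - r)) * M := by fun_prop
  have h1 : ‖∫ r in (0 : ℝ)..t, f r‖ ≤ ∫ r in (0 : ℝ)..t, Real.exp (-κ * (t - r)) * M := by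
    refine intervalIntegral.norm_integral_le_of_norm_le ht (Eventually.of_forall fun r hr => ?_)
      (hcont.intervalIntegrable _ _)
    have := hf r hr
    rwa [max_eq_left (by linarith [hr.2])] at this
  have h2 : ∫ r in (0 : ℝ)..t, Real.exp (-κ * (t - r)) * M =
      Real.exp (-κ * (t - t)) * M / κ - Real.exp (-κ * (t - 0)) * M / κ := by
    refine intervalIntegral.integral_eq_sub_of_hasDerivAt
      (f := fun r => Real.exp (-κ * (t - r)) * M / κ) (fun r _ => ?_)
      (hcont.intervalIntegrable _ _)
    have hd := (((((hasDerivAt_id r).const_sub t).const_mul (-κ)).exp).mul_const M).div_const κ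
    convert! hd using 1
    field_simp
    simp [mul_comm]
  rw [h2] at h1
  simp only [sub_self, mul_zero, Real.exp_zero, one_mul] at h1
  have : 0 ≤ Real.exp (-κ * (t - 0)) * M / κ := by positivity
  linarith

namespace HilbertBasis

variable {ι E : Type*} [NormedAddCommGroup E] [InnerProductSpace ℂ E]

/-- `u` solves `u_i' = a_i u_i + g_i` on `[0, S]` in each coordinate of the basis. -/
def SolvesDiagonal (e : HilbertBasis ι ℂ E) (a : ι → ℂ) (g u : ℝ → E) (S : ℝ) : Prop :=
  ∀ i, ∀ t ∈ Set.Icc 0 S, HasDerivWithinAt (fun r => e.repr (u r) i)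
    (a i * e.repr (u t) i + e.repr (g t) i) (Set.Icc 0 S) t

/-- A diagonal dissipative evolution equation with a Lipschitz nonlinearity is globally solvable. -/
theorem exists_solvesDiagonal [CompleteSpace E] (e : HilbertBasis ι ℂ E) {a : ι → ℂ}
    (ha : ∀ i, (a i).re ≤ 0) {G : E → E} {K : ℝ≥0} (hG : LipschitzWith K G) (hG0 : G 0 = 0)
    (u₀ : E) :
    ∃ u : ℝ → E, Continuous u ∧ u 0 = u₀ ∧ ∀ S, e.SolvesDiagonal a (fun t => G (u t)) u S := by
  -- The unknown becomes `w = exp (-κ t) u`, which shifts the symbol by `-κ`. This choice makes the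
  -- contraction constant `K / κ` at most `1/2`, with no restriction on time.
  set κ : ℝ := 2 * K + 1 with hκdef
  have hK0 : (0 : ℝ) ≤ K := K.2
  have hκ : 0 < κ := by positivity
  obtain ⟨Sg, hSrepr, hSlip, hScont⟩ := e.exists_diagonal_semigroup (κ := κ)
    (a := fun i => a i - κ) (fun i => by simpa using ha i) hκ.le
  have hS0 : ∀ t, Sg t 0 = 0 := fun t => e.ext_repr fun i => by rw [hSrepr]; simp
  set H : (ℝ →ᵇ E) → ℝ → E := fun w r =>
    Real.exp (-κ * r) • G (Real.exp (κ * r) • w r) with hHdef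
  have hHcont : ∀ w, Continuous (H w) := fun w => by
    have := w.continuous
    have hGc := hG.continuous
    fun_prop
  have hHlip : ∀ w w' r, ‖H w r - H w' r‖ ≤ K * ‖w - w'‖ := by
    intro w w' r
    simp only [hHdef]
    rw [← smul_sub, norm_smul, Real.norm_of_nonneg (Real.exp_pos _).le]
    have h1 := hG.dist_le_mul (Real.exp (κ * r) • w r) (Real.exp (κ * r) • w' r)
    rw [dist_eq_norm, dist_eq_norm, ← smul_sub, norm_smul,
      Real.norm_of_nonneg (Real.exp_pos _).le] at h1
    have h2 : ‖w r - w' r‖ ≤ ‖w - w'‖ := (w - w').norm_coe_le_norm r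
    calc _ ≤ Real.exp (-κ * r) * (K * (Real.exp (κ * r) * ‖w r - w' r‖)) := by gcongr
      _ = (Real.exp (-κ * r) * Real.exp (κ * r)) * (K * ‖w r - w' r‖) := by ring
      _ = K * ‖w r - w' r‖ := by rw [← Real.exp_add]; simp
      _ ≤ _ := by gcongr
  have hH0 : ∀ r, H 0 r = 0 := fun r => by simp [hHdef, hG0]
  have hfc : ∀ w, Continuous (Function.uncurry fun t r => Sg (t - r) (H w r)) := fun w => by
    have h1 := hHcont w
    exact hScont.comp (Continuous.prodMk (continuous_fst.sub continuous_snd)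
      (h1.comp continuous_snd))
  set I : (ℝ →ᵇ E) → ℝ → E := fun w t => ∫ r in (0 : ℝ)..max t 0, Sg (t - r) (H w r) with hIdef
  have hIcont : ∀ w, Continuous (I w) := fun w =>
    intervalIntegral.continuous_parametric_intervalIntegral_of_continuous (hfc w) (by fun_prop)
  have hint : ∀ w t x y, IntervalIntegrable (fun r => Sg (t - r) (H w r)) volume x y :=
    fun w t x y => ((hfc w).comp (Continuous.prodMk_right t)).intervalIntegrable x y
  have hIlip : ∀ w w' t, ‖I w t - I w' t‖ ≤ K * ‖w - w'‖ / κ := by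
    intro w w' t
    simp only [hIdef]
    rw [← intervalIntegral.integral_sub (hint w t _ _) (hint w' t _ _)]
    refine norm_integral_le_of_exp_decay hκ (by positivity) fun r _ => ?_
    exact (hSlip _ _ _).trans (by gcongr; exact hHlip w w' r)
  have hI0 : ∀ t, I 0 t = 0 := fun t => by simp [hIdef, hH0, hS0]
  have hScont0 : Continuous fun t => Sg t u₀ := hScont.comp (Continuous.prodMk_left u₀)
  have hbd : ∀ w t, ‖Sg t u₀ + I w t‖ ≤ ‖u₀‖ + K * ‖w‖ / κ := by
    intro w t
    refine (norm_add_le _ _).trans (add_le_add ?_ ?_)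
    · have := hSlip t u₀ 0
      rw [hS0, sub_zero, sub_zero] at this
      refine this.trans (mul_le_of_le_one_left (norm_nonneg _) (Real.exp_le_one_iff.2 ?_))
      have := mul_nonneg hκ.le (le_max_right t 0)
      linarith
    · have := hIlip w 0 t
      rwa [hI0, sub_zero, sub_zero] at this
  set Ψ : (ℝ →ᵇ E) → (ℝ →ᵇ E) := fun w =>
    BoundedContinuousFunction.ofNormedAddCommGroup (fun t => Sg t u₀ + I w t)
      (hScont0.add (hIcont w)) _ (hbd w) with hΨdef
  have hΨ : ContractingWith 2⁻¹ Ψ := by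
    refine ⟨by rw [← NNReal.coe_lt_coe]; norm_num, LipschitzWith.of_dist_le_mul fun w w' => ?_⟩
    rw [BoundedContinuousFunction.dist_le (by positivity)]
    intro t
    rw [dist_eq_norm, dist_eq_norm]
    simp only [hΨdef, BoundedContinuousFunction.coe_ofNormedAddCommGroup, add_sub_add_left_eq_sub]
    refine (hIlip w w' t).trans ?_
    rw [div_le_iff₀ hκ]
    have : 0 ≤ ‖w - w'‖ := norm_nonneg _
    push_cast
    rw [hκdef]
    nlinarith
  set w := hΨ.fixedPoint Ψ
  have hw : ∀ t, w t = Sg t u₀ + I w t := fun t => by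
    have h : Ψ w = w := hΨ.fixedPoint_isFixedPt
    conv_lhs => rw [← h]
    rfl
  set u : ℝ → E := fun t => Real.exp (κ * t) • w t with hudef
  have hucont : Continuous u := by
    have := w.continuous
    fun_prop
  have hHu : ∀ r, H w r = Real.exp (-κ * r) • G (u r) := fun r => rfl
  refine ⟨u, hucont, ?_, fun S i t ht => ?_⟩
  · simp only [hudef, mul_zero, Real.exp_zero, one_smul]
    rw [hw 0]
    refine e.ext_repr fun i => ?_
    simp [hIdef, hSrepr]
  · set g : ℝ → ℂ := fun r => e.repr (G (u r)) i with hgdef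
    have hgcont : Continuous g :=
      (e.coordCLM i).continuous.comp (hG.continuous.comp hucont)
    set h : ℝ → ℂ := fun r => Complex.exp (-a i * r) * g r with hhdef
    have hhcont : Continuous h := by fun_prop
    -- The exponential weights cancel and leave the scalar Duhamel formula for `u`, which can be
    -- differentiated even though the symbol is unbounded over the indices.
    have hform : ∀ t, 0 ≤ t → e.repr (u t) i =
        Complex.exp (a i * t) * (e.repr u₀ i + ∫ r in (0 : ℝ)..t, h r) := by
      intro t ht
      have h1 : e.repr (I w t) i =
          ∫ r in (0 : ℝ)..t, Complex.exp ((a i - κ) * t) * h r := by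
        rw [← coordCLM_apply]
        simp only [hIdef, max_eq_left ht]
        rw [← ContinuousLinearMap.intervalIntegral_comp_comm _ (hint w t _ _)]
        refine intervalIntegral.integral_congr fun r hr => ?_
        rw [Set.uIcc_of_le ht] at hr
        simp only [coordCLM_apply, hSrepr, hHu, hhdef, hgdef, max_eq_left (sub_nonneg.2 hr.2)]
        have h3 : e.repr (Real.exp (-κ * r) • G (u r)) i =
            (Real.exp (-κ * r) : ℂ) * e.repr (G (u r)) i := by
          rw [← Complex.coe_smul]
          simp
        rw [h3, ← mul_assoc, ← mul_assoc, Complex.ofReal_exp, ← Complex.exp_add,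
          ← Complex.exp_add]
        congr 2
        push_cast
        ring
      have h2 : e.repr (u t) i = (Real.exp (κ * t) : ℂ) * e.repr (w t) i := by
        simp only [hudef]
        rw [← Complex.coe_smul]
        simp
      rw [h2, hw t, map_add, lp.coeFn_add, Pi.add_apply, h1, hSrepr, max_eq_left ht,
        intervalIntegral.integral_const_mul, ← mul_add, ← mul_assoc, Complex.ofReal_exp,
        ← Complex.exp_add]
      congr 2
      push_cast
      ring
    have hd : HasDerivAt (fun t : ℝ =>
        Complex.exp (a i * t) * (e.repr u₀ i + ∫ r in (0 : ℝ)..t, h r))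
        (Complex.exp (a i * t) * (a i * 1) * (e.repr u₀ i + ∫ r in (0 : ℝ)..t, h r) +
          Complex.exp (a i * t) * h t) t := by
      refine HasDerivAt.mul ?_ ?_
      · exact ((hasDerivAt_id t).ofReal_comp.const_mul (a i)).cexp
      · exact (intervalIntegral.integral_hasDerivAt_right (hhcont.intervalIntegrable _ _)
          (hhcont.stronglyMeasurableAtFilter _ _) hhcont.continuousAt).const_add _
    have := hd.hasDerivWithinAt.congr (s := Set.Icc 0 S) (fun r hr => hform r hr.1)
      (hform t ht.1)
    have hexp : Complex.exp (a i * t) * h t = g t := by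
      simp only [hhdef]
      rw [← mul_assoc, ← Complex.exp_add]
      simp
    rw [hexp] at this
    convert! this using 1
    rw [hform t ht.1]
    ring

end HilbertBasis

/-! ### Energy estimates and Gronwall uniqueness for diagonal systems. -/

theorem norm_sq_le_add_integral {z z' : ℝ → ℂ} {φ : ℝ → ℝ} {S T : ℝ} (hT : T ∈ Set.Icc 0 S)
    (hz : ∀ t ∈ Set.Icc 0 S, HasDerivWithinAt z (z' t) (Set.Icc 0 S) t)
    (hφ : ContinuousOn φ (Set.Icc 0 S))
    (h : ∀ t ∈ Set.Icc 0 S, 2 * inner ℝ (z t) (z' t) ≤ φ t) :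
    ‖z T‖ ^ 2 ≤ ‖z 0‖ ^ 2 + ∫ r in (0 : ℝ)..T, φ r := by
  have hsub : Set.Icc 0 T ⊆ Set.Icc 0 S := Set.Icc_subset_Icc_right hT.2
  have := intervalIntegral.sub_le_integral_of_hasDeriv_right_of_le (a := 0) (b := T)
    (g := fun t => ‖z t‖ ^ 2) (g' := fun t => 2 * inner ℝ (z t) (z' t)) (φ := φ) hT.1
    (fun t ht => ((hz t (hsub ht)).norm_sq.continuousWithinAt).mono hsub)
    (fun t ht => ((hz t (hsub ⟨ht.1.le, ht.2.le⟩)).norm_sq.hasDerivAt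
      (Icc_mem_nhds ht.1 (ht.2.trans_le hT.2))).hasDerivWithinAt)
    (hφ.mono hsub).integrableOn_Icc (fun t ht => h t (hsub ⟨ht.1.le, ht.2.le⟩))
  linarith

/-- Gronwall for the primitive `F` of `f`: `F 0 = 0` and `F' = f ≤ K F` force `F = 0`. -/
theorem eq_zero_of_le_mul_integral {f : ℝ → ℝ} {K S : ℝ}
    (hf : ContinuousOn f (Set.Icc 0 S)) (hf0 : ∀ t ∈ Set.Icc 0 S, 0 ≤ f t)
    (h : ∀ t ∈ Set.Icc 0 S, f t ≤ K * ∫ r in (0 : ℝ)..t, f r) :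
    ∀ t ∈ Set.Icc 0 S, f t = 0 := by
  intro t ht
  have hS : 0 ≤ S := ht.1.trans ht.2
  have hint : ∀ t ∈ Set.Icc 0 S, IntervalIntegrable f volume 0 t := fun t ht =>
    (hf.mono (Set.Icc_subset_Icc_right ht.2)).intervalIntegrable_of_Icc ht.1
  have hnn : ∀ t ∈ Set.Icc 0 S, 0 ≤ ∫ r in (0 : ℝ)..t, f r := fun t ht =>
    intervalIntegral.integral_nonneg ht.1 fun r hr => hf0 r ⟨hr.1, hr.2.trans ht.2⟩
  have hF : (∫ r in (0 : ℝ)..t, f r) = 0 := by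
    have := eq_zero_of_abs_deriv_le_mul_abs_self_of_eq_zero_right (K := K) (a := 0) (b := S)
      (f := fun t => ∫ r in (0 : ℝ)..t, f r) (f' := f) ?_ ?_ (by simp) ?_ t ht
    · exact this
    · have := intervalIntegral.continuousOn_primitive_interval (μ := volume) (f := f)
        (a := 0) (b := S) (by rw [Set.uIcc_of_le hS]; exact hf.integrableOn_Icc)
      rwa [Set.uIcc_of_le hS] at this
    · intro x hx
      have hx' : x ∈ Set.Icc 0 S := ⟨hx.1, hx.2.le⟩
      have hnhds : Set.Icc 0 S ∈ 𝓝[>] x :=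
        mem_of_superset (Ioo_mem_nhdsGT hx.2) fun y hy => ⟨hx.1.trans hy.1.le, hy.2.le⟩
      refine intervalIntegral.integral_hasDerivWithinAt_right (s := Set.Ici x) (t := Set.Ioi x)
        (hint x hx') ?_ ?_
      · exact ⟨Set.Icc 0 S, hnhds, hf.aestronglyMeasurable measurableSet_Icc⟩
      · exact (hf x hx').mono_of_mem_nhdsWithin hnhds
    · intro x hx
      have hx' : x ∈ Set.Icc 0 S := ⟨hx.1, hx.2.le⟩
      rw [Real.norm_of_nonneg (hf0 x hx'), Real.norm_of_nonneg (hnn x hx')]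
      exact h x hx'
  have h1 := h t ht
  rw [hF, mul_zero] at h1
  exact le_antisymm h1 (hf0 t ht)

namespace HilbertBasis

variable {ι E : Type*} [NormedAddCommGroup E] [InnerProductSpace ℂ E]

theorem hasSum_inner_repr (e : HilbertBasis ι ℂ E) (f g : E) :
    HasSum (fun i => inner ℝ (e.repr f i) (e.repr g i)) (inner ℂ f g).re := by
  have h := Complex.hasSum_re (lp.hasSum_inner (𝕜 := ℂ) (e.repr f) (e.repr g))
  rw [LinearIsometryEquiv.inner_map_map] at h
  exact h

theorem inner_self_mul_add (a z g : ℂ) :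
    inner ℝ z (a * z + g) = a.re * ‖z‖ ^ 2 + inner ℝ z g := by
  rw [Complex.sq_norm, Complex.normSq_apply]
  simp only [Complex.inner, Complex.mul_re, Complex.conj_re, Complex.conj_im, Complex.add_re,
    Complex.add_im, Complex.mul_im]
  ring

variable {e : HilbertBasis ι ℂ E} {a : ι → ℂ} {g u : ℝ → E} {S : ℝ}

theorem continuousOn_repr (e : HilbertBasis ι ℂ E) {u : ℝ → E} {s : Set ℝ}
    (hu : ContinuousOn u s) (i : ι) : ContinuousOn (fun r => e.repr (u r) i) s :=
  (e.coordCLM i).continuous.comp_continuousOn hu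

/-- The energy inequality is proved in each coordinate and then summed, since `u` is only continuous
in `E` and need not be differentiable there. -/
theorem SolvesDiagonal.norm_sq_le [Countable ι] (h : e.SolvesDiagonal a g u S)
    (ha : ∀ i, (a i).re ≤ 0) (hu : ContinuousOn u (Set.Icc 0 S))
    (hg : ContinuousOn g (Set.Icc 0 S)) {t : ℝ} (ht : t ∈ Set.Icc 0 S) :
    ‖u t‖ ^ 2 ≤ ‖u 0‖ ^ 2 + ∫ r in (0 : ℝ)..t, 2 * (inner ℂ (u r) (g r)).re := by
  have hsub : Set.Icc 0 t ⊆ Set.Icc 0 S := Set.Icc_subset_Icc_right ht.2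
  have hui := fun i => e.continuousOn_repr hu i
  have hgi := fun i => e.continuousOn_repr hg i
  have hφ : ∀ i, ContinuousOn (fun r => 2 * inner ℝ (e.repr (u r) i) (e.repr (g r) i))
      (Set.Icc 0 S) := fun i => ((hui i).inner (hgi i)).const_mul 2
  have h1 : ∀ i, ‖e.repr (u t) i‖ ^ 2 ≤ ‖e.repr (u 0) i‖ ^ 2 +
      ∫ r in (0 : ℝ)..t, 2 * inner ℝ (e.repr (u r) i) (e.repr (g r) i) := by
    intro i
    refine norm_sq_le_add_integral ht (h i) (hφ i) fun r _ => ?_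
    rw [inner_self_mul_add]
    nlinarith [mul_nonneg (neg_nonneg.2 (ha i)) (sq_nonneg ‖e.repr (u r) i‖)]
  refine hasSum_le h1 (e.hasSum_norm_sq_repr (u t)) ((e.hasSum_norm_sq_repr (u 0)).add ?_)
  have hsum : ∀ r, HasSum (fun i => ‖e.repr (u r) i‖ ^ 2 + ‖e.repr (g r) i‖ ^ 2)
      (‖u r‖ ^ 2 + ‖g r‖ ^ 2) := fun r =>
    (e.hasSum_norm_sq_repr (u r)).add (e.hasSum_norm_sq_repr (g r))
  refine intervalIntegral.hasSum_integral_of_dominated_convergence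
    (fun i r => ‖e.repr (u r) i‖ ^ 2 + ‖e.repr (g r) i‖ ^ 2) (fun i => ?_) (fun i => ?_)
    (Eventually.of_forall fun r _ => (hsum r).summable) ?_
    (Eventually.of_forall fun r _ => (e.hasSum_inner_repr (u r) (g r)).mul_left 2)
  · rw [Set.uIoc_of_le ht.1]
    exact ((hφ i).mono (Set.Ioc_subset_Icc_self.trans hsub)).aestronglyMeasurable
      measurableSet_Ioc
  · refine Eventually.of_forall fun r _ => ?_
    have h2 := norm_inner_le_norm (𝕜 := ℝ) (e.repr (u r) i) (e.repr (g r) i)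
    rw [norm_mul, Real.norm_of_nonneg (zero_le_two)]
    nlinarith [sq_nonneg (‖e.repr (u r) i‖ - ‖e.repr (g r) i‖)]
  · simp_rw [fun r => (hsum r).tsum_eq]
    exact (((hu.norm.pow 2).add (hg.norm.pow 2)).mono hsub).intervalIntegrable_of_Icc ht.1

/-- Parabolic gain: `2xy - 2νx² ≤ y² / (2ν)`, and multiplication by `ν` removes it from the forcing
term. The integral runs up to `S` so that the bound does not depend on `t`. -/
theorem SolvesDiagonal.mul_norm_sq_repr_le (h : e.SolvesDiagonal a g u S) {ν : ι → ℝ}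
    (hν : ∀ i, 0 ≤ ν i) (ha : ∀ i, (a i).re = -ν i)
    (hg : ContinuousOn g (Set.Icc 0 S)) {t : ℝ} (ht : t ∈ Set.Icc 0 S) (i : ι) :
    ν i * ‖e.repr (u t) i‖ ^ 2 ≤ ν i * ‖e.repr (u 0) i‖ ^ 2 +
      2⁻¹ * ∫ r in (0 : ℝ)..S, ‖e.repr (g r) i‖ ^ 2 := by
  have hgi := (e.continuousOn_repr hg i).norm.pow 2
  have hSpos : 0 ≤ S := ht.1.trans ht.2
  have hmono : ∫ r in (0 : ℝ)..t, ‖e.repr (g r) i‖ ^ 2 ≤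
      ∫ r in (0 : ℝ)..S, ‖e.repr (g r) i‖ ^ 2 :=
    intervalIntegral.integral_mono_interval le_rfl ht.1 ht.2
      (Eventually.of_forall fun r => sq_nonneg _) (hgi.intervalIntegrable_of_Icc hSpos)
  rcases (hν i).eq_or_lt with h0 | hpos
  · rw [← h0]
    have : 0 ≤ ∫ r in (0 : ℝ)..S, ‖e.repr (g r) i‖ ^ 2 :=
      intervalIntegral.integral_nonneg hSpos fun r _ => sq_nonneg _
    linarith
  have h1 : ‖e.repr (u t) i‖ ^ 2 ≤ ‖e.repr (u 0) i‖ ^ 2 +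
      ∫ r in (0 : ℝ)..t, (2 * ν i)⁻¹ * ‖e.repr (g r) i‖ ^ 2 := by
    refine norm_sq_le_add_integral ht (h i) (hgi.const_mul _) fun r _ => ?_
    rw [inner_self_mul_add, ha i]
    have h2 := real_inner_le_norm (e.repr (u r) i) (e.repr (g r) i)
    set x := ‖e.repr (u r) i‖
    set y := ‖e.repr (g r) i‖
    have h3 : 2 * (-ν i * x ^ 2 + x * y) ≤ (2 * ν i)⁻¹ * y ^ 2 := by
      rw [inv_mul_eq_div, le_div_iff₀ (by positivity)]
      nlinarith [sq_nonneg (2 * ν i * x - y)]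
    linarith
  rw [intervalIntegral.integral_const_mul] at h1
  have h2 := mul_le_mul_of_nonneg_left h1 hpos.le
  rw [mul_add] at h2
  have h3 : ν i * ((2 * ν i)⁻¹ * ∫ r in (0 : ℝ)..t, ‖e.repr (g r) i‖ ^ 2) =
      2⁻¹ * ∫ r in (0 : ℝ)..t, ‖e.repr (g r) i‖ ^ 2 := by
    field_simp
  rw [h3] at h2
  linarith

theorem sum_integral_norm_sq_repr_le (e : HilbertBasis ι ℂ E) {g : ℝ → E} {S M : ℝ}
    (hS : 0 ≤ S) (hg : ContinuousOn g (Set.Icc 0 S)) (hM : ∀ t ∈ Set.Icc 0 S, ‖g t‖ ≤ M)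
    (F : Finset ι) :
    ∑ i ∈ F, ∫ r in (0 : ℝ)..S, ‖e.repr (g r) i‖ ^ 2 ≤ S * M ^ 2 := by
  have hgi : ∀ i, ContinuousOn (fun r => ‖e.repr (g r) i‖ ^ 2) (Set.Icc 0 S) :=
    fun i => (e.continuousOn_repr hg i).norm.pow 2
  rw [← intervalIntegral.integral_finsetSum fun i _ => (hgi i).intervalIntegrable_of_Icc hS]
  have hc : ∫ _ in (0 : ℝ)..S, M ^ 2 = S * M ^ 2 := by simp
  rw [← hc]
  refine intervalIntegral.integral_mono_on hS
    ((continuousOn_finsetSum F fun i _ => hgi i).intervalIntegrable_of_Icc hS)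
    intervalIntegrable_const fun r hr => ?_
  exact (sum_le_hasSum F (fun i _ => sq_nonneg _) (e.hasSum_norm_sq_repr (g r))).trans
    (pow_le_pow_left₀ (norm_nonneg _) (hM r hr) 2)

theorem SolvesDiagonal.eqOn [Countable ι] {G : E → E} {K : ℝ≥0} (hG : LipschitzWith K G)
    (ha : ∀ i, (a i).re ≤ 0) {u v : ℝ → E}
    (hus : e.SolvesDiagonal a (fun t => G (u t)) u S) (hu : ContinuousOn u (Set.Icc 0 S))
    (hvs : e.SolvesDiagonal a (fun t => G (v t)) v S) (hv : ContinuousOn v (Set.Icc 0 S))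
    (h0 : u 0 = v 0) : Set.EqOn u v (Set.Icc 0 S) := by
  have hGu := hG.continuous.comp_continuousOn hu
  have hGv := hG.continuous.comp_continuousOn hv
  have hw : e.SolvesDiagonal a (fun t => G (u t) - G (v t)) (fun t => u t - v t) S := by
    intro i t ht
    have := (hus i t ht).sub (hvs i t ht)
    simp only [map_sub, lp.coeFn_sub, Pi.sub_apply]
    convert! this using 1
    ring
  have hz := eq_zero_of_le_mul_integral (f := fun t => ‖u t - v t‖ ^ 2) (K := 2 * K) (S := S)
    ((hu.sub hv).norm.pow 2) (fun t _ => sq_nonneg _) fun t ht => by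
      have h1 := hw.norm_sq_le ha (hu.sub hv) (hGu.sub hGv) ht
      simp only [h0, sub_self, norm_zero, ne_eq, OfNat.ofNat_ne_zero, not_false_eq_true,
        zero_pow, zero_add] at h1
      refine h1.trans ?_
      have hsub : Set.Icc 0 t ⊆ Set.Icc 0 S := Set.Icc_subset_Icc_right ht.2
      rw [← intervalIntegral.integral_const_mul]
      refine intervalIntegral.integral_mono_on ht.1 ?_ ?_ fun r _ => ?_
      · refine ContinuousOn.intervalIntegrable_of_Icc ht.1 (ContinuousOn.mono ?_ hsub)
        exact (Complex.continuous_re.comp_continuousOn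
          ((hu.sub hv).inner (hGu.sub hGv))).const_mul 2
      · exact ((((hu.sub hv).norm.pow 2).const_mul _).mono hsub).intervalIntegrable_of_Icc ht.1
      · have h2 : (inner ℂ (u r - v r) (G (u r) - G (v r))).re ≤
            ‖u r - v r‖ * ‖G (u r) - G (v r)‖ :=
          (Complex.re_le_norm _).trans (norm_inner_le_norm _ _)
        have h3 := hG.dist_le_mul (u r) (v r)
        rw [dist_eq_norm, dist_eq_norm] at h3
        nlinarith [norm_nonneg (u r - v r)]
  intro t ht
  have := hz t ht
  exact sub_eq_zero.1 (norm_eq_zero.1 (pow_eq_zero_iff (two_ne_zero) |>.1 this))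

end HilbertBasis

/-! ### The truncated nonlinearity on `L²`. -/

namespace CGL

/-- A mean value bound in which the factor `y` avoids the exponent `n - 1`; `y` plays the role of
the smaller modulus in the next estimate. -/
theorem pow_sub_pow_mul_le {x y : ℝ} (hy : 0 ≤ y) (hxy : y ≤ x) (n : ℕ) :
    (x ^ n - y ^ n) * y ≤ n * x ^ n * (x - y) := by
  have hx : 0 ≤ x := hy.trans hxy
  induction n with
  | zero => simp
  | succ n ih =>
    have h1 : y ^ (n + 1) * (x - y) ≤ x ^ (n + 1) * (x - y) :=
      mul_le_mul_of_nonneg_right (pow_le_pow_left₀ hy hxy _) (sub_nonneg.2 hxy)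
    have h2 := mul_le_mul_of_nonneg_left ih hx
    have h3 : (x ^ (n + 1) - y ^ (n + 1)) * y =
        x * ((x ^ n - y ^ n) * y) + y ^ (n + 1) * (x - y) := by ring
    have h4 : ((n + 1 : ℕ) : ℝ) * x ^ (n + 1) * (x - y) =
        x * (n * x ^ n * (x - y)) + x ^ (n + 1) * (x - y) := by push_cast; ring
    rw [h3, h4]
    linarith

/-- `z ↦ |z|^n z` with the modulus truncated at `R`. -/
def truncMonomial (R : ℝ≥0) (n : ℕ) (z : ℂ) : ℂ :=
  ((min ‖z‖ R ^ n : ℝ) : ℂ) * z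

theorem truncMonomial_zero (R : ℝ≥0) (n : ℕ) : truncMonomial R n 0 = 0 := by
  simp [truncMonomial]

theorem lipschitzWith_truncMonomial (R : ℝ≥0) (n : ℕ) :
    LipschitzWith ((n + 1) * R ^ n) (truncMonomial R n) := by
  have key : ∀ z w : ℂ, ‖w‖ ≤ ‖z‖ →
      ‖truncMonomial R n z - truncMonomial R n w‖ ≤ (n + 1) * (R : ℝ) ^ n * ‖z - w‖ := by
    intro z w hzw
    set x := min ‖z‖ (R : ℝ)
    set y := min ‖w‖ (R : ℝ)
    have hR : (0 : ℝ) ≤ R := R.2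
    have hy0 : 0 ≤ y := le_min (norm_nonneg _) hR
    have hyx : y ≤ x := min_le_min_right _ hzw
    have hxR : x ^ n ≤ (R : ℝ) ^ n := pow_le_pow_left₀ (hy0.trans hyx) (min_le_right _ _) n
    -- The change of the multiplier is tested against the smaller modulus. If that modulus exceeds
    -- `R`, both multipliers equal `R ^ n` and nothing remains.
    have hdiff : (x ^ n - y ^ n) * ‖w‖ ≤ n * (R : ℝ) ^ n * ‖z - w‖ := by
      rcases le_total ‖w‖ (R : ℝ) with h | h
      · have hyw : y = ‖w‖ := min_eq_left h
        have h1 := pow_sub_pow_mul_le hy0 hyx n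
        have h2 : x - y ≤ ‖z - w‖ := by
          have := norm_sub_norm_le z w
          have := min_le_left ‖z‖ (R : ℝ)
          rw [hyw]
          linarith
        rw [← hyw]
        refine h1.trans ?_
        gcongr
      · have hyR : y = R := min_eq_right h
        have hxR : x = R := min_eq_right (h.trans hzw)
        rw [hyR, hxR, sub_self, zero_mul]
        positivity
    have heq : truncMonomial R n z - truncMonomial R n w =
        ((x ^ n : ℝ) : ℂ) * (z - w) + ((x ^ n - y ^ n : ℝ) : ℂ) * w := by
      simp only [truncMonomial]
      push_cast
      ring
    rw [heq]
    refine (norm_add_le _ _).trans ?_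
    rw [norm_mul, norm_mul, Complex.norm_real, Complex.norm_real,
      Real.norm_of_nonneg (pow_nonneg (hy0.trans hyx) n),
      Real.norm_of_nonneg (sub_nonneg.2 (pow_le_pow_left₀ hy0 hyx n))]
    have := mul_le_mul_of_nonneg_right hxR (norm_nonneg (z - w))
    linarith
  refine LipschitzWith.of_dist_le_mul fun z w => ?_
  rw [dist_eq_norm, dist_eq_norm]
  push_cast
  rcases le_total ‖w‖ ‖z‖ with h | h
  · exact key z w h
  · rw [norm_sub_rev, norm_sub_rev z w]
    exact key w z h

variable {d : ℕ}

/-- The operator `w ↦ |w|^n w` on `L²`, with the modulus truncated at `R`. -/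
def truncPow (R : ℝ≥0) (n : ℕ) (w : L2 d) : L2 d :=
  (lipschitzWith_truncMonomial R n).compLp (truncMonomial_zero R n) w

theorem coeFn_truncPow (R : ℝ≥0) (n : ℕ) (w : L2 d) :
    truncPow R n w =ᵐ[torusMeasure d] fun y => truncMonomial R n (w y) :=
  LipschitzWith.coeFn_compLp _ _ w

theorem lipschitzWith_truncPow (R : ℝ≥0) (n : ℕ) :
    LipschitzWith ((n + 1) * R ^ n) (truncPow (d := d) R n) :=
  (lipschitzWith_truncMonomial R n).lipschitzWith_compLp (truncMonomial_zero R n)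

theorem truncPow_zero (R : ℝ≥0) (n : ℕ) : truncPow (d := d) R n 0 = 0 :=
  LipschitzWith.compLp_zero _ _

theorem norm_truncPow_le (R : ℝ≥0) (n : ℕ) (w : L2 d) : ‖truncPow R n w‖ ≤ R ^ n * ‖w‖ := by
  refine Lp.norm_le_mul_norm_of_ae_le_mul ?_
  filter_upwards [coeFn_truncPow R n w] with y hy
  have h0 : 0 ≤ min ‖w y‖ (R : ℝ) := le_min (norm_nonneg _) R.2
  rw [hy, truncMonomial, norm_mul, Complex.norm_real, Real.norm_of_nonneg (pow_nonneg h0 n)]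
  gcongr
  exact min_le_right _ _

/-- Truncation still multiplies `w` by a nonnegative function, so the `b` term dissipates and the
`ic` term contributes nothing to the energy. -/
theorem inner_truncPow (R : ℝ≥0) (n : ℕ) (w : L2 d) :
    ∃ x : ℝ, 0 ≤ x ∧ inner ℂ w (truncPow R n w) = x := by
  refine ⟨∫ y, min ‖w y‖ R ^ n * ‖w y‖ ^ 2 ∂torusMeasure d,
    integral_nonneg fun y => mul_nonneg (pow_nonneg (le_min (norm_nonneg _) R.2) n)
      (sq_nonneg _), ?_⟩
  rw [L2.inner_def, ← integral_complex_ofReal]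
  refine integral_congr_ae ?_
  filter_upwards [coeFn_truncPow R n w] with y hy
  rw [hy, truncMonomial, RCLike.inner_apply, mul_assoc, Complex.mul_conj,
    Complex.normSq_eq_norm_sq]
  push_cast
  rfl

/-- The nonlinearity `b |w|^{2p} w + i c |w|^{2q} w` with the moduli truncated at `R`. -/
def truncNL (b c : ℝ) (p q : ℕ) (R : ℝ≥0) (w : L2 d) : L2 d :=
  (b : ℂ) • truncPow R (2 * p) w + (Complex.I * c) • truncPow R (2 * q) w

theorem exists_lipschitzWith_truncNL (b c : ℝ) (p q : ℕ) (R : ℝ≥0) :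
    ∃ K, LipschitzWith K (truncNL (d := d) b c p q R) :=
  ⟨_, ((lipschitzWith_smul (b : ℂ)).comp (lipschitzWith_truncPow R (2 * p))).add
    ((lipschitzWith_smul (Complex.I * c : ℂ)).comp (lipschitzWith_truncPow R (2 * q)))⟩

theorem truncNL_zero (b c : ℝ) (p q : ℕ) (R : ℝ≥0) : truncNL (d := d) b c p q R 0 = 0 := by
  simp [truncNL, truncPow_zero]

theorem norm_truncNL_le (b c : ℝ) (p q : ℕ) {R : ℝ≥0} (hR : 1 ≤ R) (w : L2 d) :
    ‖truncNL b c p q R w‖ ≤ (|b| + |c|) * R ^ (2 * (p + q)) * ‖w‖ := by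
  have hR' : (1 : ℝ) ≤ R := hR
  have h : ∀ n, n ≤ p + q → ‖truncPow R (2 * n) w‖ ≤ R ^ (2 * (p + q)) * ‖w‖ := fun n hn =>
    (norm_truncPow_le R (2 * n) w).trans
      (mul_le_mul_of_nonneg_right (pow_le_pow_right₀ hR' (by omega)) (norm_nonneg _))
  refine (norm_add_le _ _).trans ?_
  rw [norm_smul, norm_smul, norm_mul, Complex.norm_I, Complex.norm_real, Complex.norm_real,
    Real.norm_eq_abs, Real.norm_eq_abs, one_mul]
  have h1 := mul_le_mul_of_nonneg_left (h p (by omega)) (abs_nonneg b)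
  have h2 := mul_le_mul_of_nonneg_left (h q (by omega)) (abs_nonneg c)
  linarith

theorem re_inner_truncNL_nonpos {b : ℝ} (hb : b ≤ 0) (c : ℝ) (p q : ℕ) (R : ℝ≥0) (w : L2 d) :
    (inner ℂ w (truncNL b c p q R w)).re ≤ 0 := by
  obtain ⟨x, hx, hxe⟩ := inner_truncPow R (2 * p) w
  obtain ⟨y, -, hye⟩ := inner_truncPow R (2 * q) w
  rw [truncNL, inner_add_right, inner_smul_right, inner_smul_right, hxe, hye]
  simpa using mul_nonpos_of_nonpos_of_nonneg hb hx

/-! ### Fourier coefficients, and sup bounds from their decay. -/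

/-- The characters of the torus, as a Hilbert basis. -/
def fourierBasis (d : ℕ) : HilbertBasis (Fin d → ℤ) ℂ (L2 d) :=
  UnitAddTorus.mFourierBasis

theorem fourierBasis_repr (w : L2 d) (k : Fin d → ℤ) : (fourierBasis d).repr w k = coeff w k :=
  UnitAddTorus.mFourierBasis_repr w k

theorem coeff_congr {v w : UnitAddTorus (Fin d) → ℂ} (h : v =ᵐ[torusMeasure d] w)
    (k : Fin d → ℤ) : coeff v k = coeff w k :=
  integral_congr_ae (h.mono fun y hy => by simp only [hy])

theorem coeff_truncPow {R : ℝ≥0} {w : L2 d} (hw : ∀ᵐ y ∂torusMeasure d, ‖w y‖ ≤ R) (n : ℕ)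
    (k : Fin d → ℤ) : coeff (truncPow R (2 * n) w) k = coeff (powNL n w) k := by
  refine coeff_congr ?_ k
  filter_upwards [coeFn_truncPow R (2 * n) w, hw] with y hy hwy
  rw [hy, truncMonomial, powNL, min_eq_left hwy]
  push_cast
  rfl

theorem coeff_truncNL {R : ℝ≥0} {w : L2 d} (hw : ∀ᵐ y ∂torusMeasure d, ‖w y‖ ≤ R) (b c : ℝ)
    (p q : ℕ) (k : Fin d → ℤ) :
    coeff (truncNL b c p q R w) k =
      b * coeff (powNL p w) k + Complex.I * c * coeff (powNL q w) k := by
  rw [← coeff_truncPow hw, ← coeff_truncPow hw, ← fourierBasis_repr, ← fourierBasis_repr,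
    ← fourierBasis_repr, truncNL, map_add, map_smul, map_smul]
  rfl

theorem coeff_sub (v w : L2 d) (k : Fin d → ℤ) : coeff (v - w : L2 d) k = coeff v k - coeff w k := by
  rw [← fourierBasis_repr, ← fourierBasis_repr, ← fourierBasis_repr]
  simp

/-- The Fourier series converges uniformly to a continuous function, whose class in `L²` is `w`. -/
theorem ae_norm_le_tsum_coeff {w : L2 d} (h : Summable fun k => ‖coeff w k‖) :
    ∀ᵐ y ∂torusMeasure d, ‖w y‖ ≤ ∑' k, ‖coeff w k‖ := by
  have hs : Summable fun k => coeff w k • UnitAddTorus.mFourier k :=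
    .of_norm (by simpa only [norm_smul, UnitAddTorus.mFourier_norm, mul_one] using h)
  set f : C(UnitAddTorus (Fin d), ℂ) := ∑' k, coeff w k • UnitAddTorus.mFourier k with hf
  have hfw : ContinuousMap.toLp (E := ℂ) 2 (torusMeasure d) ℂ f = w := by
    have h1 := hs.hasSum.mapL (ContinuousMap.toLp (E := ℂ) 2 (torusMeasure d) ℂ)
    have h2 := UnitAddTorus.hasSum_mFourier_series_L2 (d := Fin d) w
    refine h1.unique ?_
    simp only [map_smul]
    exact h2
  have hae := ContinuousMap.coeFn_toLp (𝕜 := ℂ) (p := 2) (torusMeasure d) f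
  rw [hfw] at hae
  filter_upwards [hae] with y hy
  rw [hy]
  refine (f.norm_coe_le_norm y).trans ?_
  rw [hf]
  refine (norm_tsum_le_tsum_norm ?_).trans (le_of_eq ?_)
  · simpa only [norm_smul, UnitAddTorus.mFourier_norm, mul_one] using h
  · simp only [norm_smul, UnitAddTorus.mFourier_norm, mul_one]

theorem eig_nonneg (ℓ : ℝ) (k : Fin d → ℤ) : 0 ≤ eig ℓ k := by
  unfold eig
  positivity

theorem summable_prod_apply {f : ℤ → ℝ} (hf : Summable f) (hf0 : ∀ n, 0 ≤ f n) :
    Summable fun k : Fin d → ℤ => ∏ j, f (k j) := by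
  classical
  refine summable_of_sum_le (c := (∑' n, f n) ^ d) (fun k => Finset.prod_nonneg fun j _ => hf0 _)
    fun F => ?_
  have hsub : F ⊆ Fintype.piFinset fun j => F.image fun k => k j := fun k hk =>
    Fintype.mem_piFinset.2 fun j => Finset.mem_image_of_mem _ hk
  refine (Finset.sum_le_sum_of_subset_of_nonneg hsub fun k _ _ =>
    Finset.prod_nonneg fun j _ => hf0 _).trans ?_
  rw [← Finset.prod_univ_sum (fun j => F.image fun k => k j) fun _ n => f n]
  calc _ ≤ ∏ _j : Fin d, ∑' n, f n :=
        Finset.prod_le_prod (fun j _ => Finset.sum_nonneg fun n _ => hf0 n)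
          fun j _ => hf.sum_le_tsum _ fun n _ => hf0 n
    _ = _ := by simp

/-- A summable weight controlling Fourier coefficients of functions of high regularity. -/
def weight (ℓ : ℝ) (k : Fin d → ℤ) : ℝ := (2 / (1 + eig ℓ k)) ^ (d + 1)

theorem weight_nonneg (ℓ : ℝ) (k : Fin d → ℤ) : 0 ≤ weight ℓ k := by
  have := eig_nonneg ℓ k
  unfold weight
  positivity

theorem summable_one_div_one_add_sq : Summable fun n : ℤ => 1 / (1 + (n : ℝ) ^ 2) := by
  have h : Summable fun n : ℤ => 1 / (n : ℝ) ^ 2 := Real.summable_one_div_int_pow.2 one_lt_two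
  refine (h.add (summable_of_hasFiniteSupport (f := fun n : ℤ => if n = 0 then (1 : ℝ) else 0)
    ((Set.finite_singleton 0).subset fun n hn => by by_contra h; simp_all))).of_nonneg_of_le
    (fun n => by positivity) fun n => ?_
  by_cases hn : n = 0
  · simp [hn]
  · have : (0 : ℝ) < (n : ℝ) ^ 2 := by positivity
    simp only [hn, if_false, add_zero]
    exact one_div_le_one_div_of_le this (by linarith)

theorem summable_weight {ℓ : ℝ} (hℓ : 0 < ℓ) : Summable (weight (d := d) ℓ) := by
  have h := ((summable_one_div_one_add_sq.mul_left (1 + ℓ ^ 2)))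
  refine ((summable_prod_apply (d := d) h fun n => by positivity).mul_left
    ((2 : ℝ) ^ (d + 1))).of_nonneg_of_le (weight_nonneg ℓ) fun k => ?_
  have he := eig_nonneg ℓ k
  rw [weight, div_eq_mul_one_div, mul_pow]
  refine mul_le_mul_of_nonneg_left ?_ (by positivity)
  have h1 : 1 / (1 + eig ℓ k) ≤ 1 := by
    rw [div_le_one (by positivity)]
    linarith
  -- One of the `d + 1` factors is dropped; the other `d` are distributed over the coordinates,
  -- using `1 + k_j² ≤ (1 + ℓ²)(1 + λ_k)`.
  rw [pow_succ]
  refine (mul_le_of_le_one_right (by positivity) h1).trans ?_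
  have h2 : (1 / (1 + eig ℓ k)) ^ d = ∏ _j : Fin d, 1 / (1 + eig ℓ k) := by simp
  rw [h2]
  refine Finset.prod_le_prod (fun _ _ => by positivity) fun j _ => ?_
  rw [mul_one_div, div_le_div_iff₀ (by positivity) (by positivity)]
  have h3 : (k j : ℝ) ^ 2 ≤ ∑ i, (k i : ℝ) ^ 2 :=
    Finset.single_le_sum (f := fun i => (k i : ℝ) ^ 2) (fun i _ => sq_nonneg _) (Finset.mem_univ j)
  have h4 : ℓ ^ 2 * eig ℓ k = ∑ i, (k i : ℝ) ^ 2 := by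
    unfold eig
    field_simp
  nlinarith

/-- Root extraction of order `2L`. The `2` in `weight` absorbs the convexity constant in `(1 + λ)^m
≤ 2^{m-1}(1 + λ^m)`. -/
theorem le_mul_weight {ℓ x A : ℝ} {L : ℕ} (hL : L ≠ 0) (hA : 0 ≤ A) {k : Fin d → ℤ}
    (h : x ^ (2 * L) * (eig ℓ k ^ (2 * L * (d + 1)) + 1) ≤ A ^ (2 * L)) :
    x ≤ A * weight ℓ k := by
  have he := eig_nonneg ℓ k
  set m := 2 * L * (d + 1) with hm
  refine le_of_pow_le_pow_left₀ (n := 2 * L) (by omega) (mul_nonneg hA (weight_nonneg ℓ k)) ?_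
  have h1 : 1 ≤ weight ℓ k ^ (2 * L) * (eig ℓ k ^ m + 1) := by
    have h2 : weight ℓ k ^ (2 * L) = 2 ^ m / (1 + eig ℓ k) ^ m := by
      rw [weight, ← pow_mul, mul_comm (d + 1), div_pow]
    rw [h2, div_mul_eq_mul_div, one_le_div (by positivity)]
    have h3 := add_pow_le zero_le_one he m
    rw [one_pow] at h3
    refine h3.trans ?_
    rw [add_comm]
    gcongr
    · norm_num
    · omega
  have hx : 0 ≤ x ^ (2 * L) := by
    rw [pow_mul]
    positivity
  calc x ^ (2 * L) ≤ x ^ (2 * L) * (weight ℓ k ^ (2 * L) * (eig ℓ k ^ m + 1)) :=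
        le_mul_of_one_le_right hx h1
    _ = (x ^ (2 * L) * (eig ℓ k ^ m + 1)) * weight ℓ k ^ (2 * L) := by ring
    _ ≤ A ^ (2 * L) * weight ℓ k ^ (2 * L) :=
        mul_le_mul_of_nonneg_right h (pow_nonneg (weight_nonneg ℓ k) _)
    _ = _ := by rw [mul_pow]

theorem ae_norm_le_of_coeff_le {ℓ : ℝ} (hℓ : 0 < ℓ) {w : L2 d} {A : ℝ}
    (h : ∀ k, ‖coeff w k‖ ≤ A * weight ℓ k) :
    ∀ᵐ y ∂torusMeasure d, ‖w y‖ ≤ A * ∑' k, weight (d := d) ℓ k := by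
  have hs := (summable_weight (d := d) hℓ).mul_left A
  have hc : Summable fun k => ‖coeff w k‖ := hs.of_nonneg_of_le (fun _ => norm_nonneg _) h
  filter_upwards [ae_norm_le_tsum_coeff hc] with y hy
  refine hy.trans ?_
  rw [← tsum_mul_left]
  exact hc.tsum_le_tsum h hs

/-! ### Sobolev norms of integer index. -/

variable {m : ℕ} {ℓ : ℝ}

theorem hasSum_norm_sq_coeff (w : L2 d) : HasSum (fun k => ‖coeff w k‖ ^ 2) (‖w‖ ^ 2) := by
  simpa only [fourierBasis_repr] using (fourierBasis d).hasSum_norm_sq_repr w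

theorem memH_natCast_iff {w : L2 d} :
    MemH ℓ m w ↔ Summable fun k => eig ℓ k ^ m * ‖coeff w k‖ ^ 2 := by
  simp only [MemH, Real.rpow_natCast, add_mul, one_mul]
  exact ⟨fun h => by simpa using h.sub (hasSum_norm_sq_coeff w).summable,
    fun h => h.add (hasSum_norm_sq_coeff w).summable⟩

theorem normH_natCast_sq {w : L2 d} (h : MemH ℓ m w) :
    normH ℓ m w ^ 2 = ∑' k, eig ℓ k ^ m * ‖coeff w k‖ ^ 2 + ‖w‖ ^ 2 := by
  rw [normH, Real.sq_sqrt (tsum_nonneg fun k => by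
    have := Real.rpow_nonneg (eig_nonneg ℓ k) m
    positivity)]
  simp only [Real.rpow_natCast, add_mul, one_mul]
  rw [(memH_natCast_iff.1 h).tsum_add (hasSum_norm_sq_coeff w).summable,
    (hasSum_norm_sq_coeff w).tsum_eq]

theorem normH_nonneg (ℓ s : ℝ) (w : L2 d) : 0 ≤ normH ℓ s w := Real.sqrt_nonneg _

theorem eig_term_nonneg (ℓ : ℝ) (m : ℕ) (w : L2 d) (k : Fin d → ℤ) :
    0 ≤ eig ℓ k ^ m * ‖coeff w k‖ ^ 2 :=
  mul_nonneg (pow_nonneg (eig_nonneg ℓ k) m) (sq_nonneg _)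

theorem norm_le_normH {w : L2 d} (h : MemH ℓ m w) : ‖w‖ ≤ normH ℓ m w := by
  refine le_of_sq_le_sq ?_ (normH_nonneg _ _ _)
  rw [normH_natCast_sq h]
  have : 0 ≤ ∑' k, eig ℓ k ^ m * ‖coeff w k‖ ^ 2 := tsum_nonneg (eig_term_nonneg ℓ m w)
  linarith

theorem mul_norm_sq_coeff_le {w : L2 d} (h : MemH ℓ m w) (k : Fin d → ℤ) :
    (eig ℓ k ^ m + 1) * ‖coeff w k‖ ^ 2 ≤ normH ℓ m w ^ 2 := by
  rw [normH_natCast_sq h, add_mul, one_mul]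
  exact add_le_add ((memH_natCast_iff.1 h).le_tsum k fun j _ => eig_term_nonneg ℓ m w j)
    (le_hasSum (hasSum_norm_sq_coeff w) k fun _ _ => sq_nonneg _)

theorem norm_sq_coeff_sub_le (v w : L2 d) (k : Fin d → ℤ) :
    ‖coeff (v - w : L2 d) k‖ ^ 2 ≤ 2 * ‖coeff v k‖ ^ 2 + 2 * ‖coeff w k‖ ^ 2 := by
  rw [coeff_sub]
  have := norm_sub_le (coeff v k) (coeff w k)
  nlinarith [norm_nonneg (coeff v k - coeff w k), sq_nonneg (‖coeff v k‖ - ‖coeff w k‖)]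

theorem MemH.sub {v w : L2 d} (hv : MemH ℓ m v) (hw : MemH ℓ m w) : MemH ℓ m (v - w) := by
  rw [memH_natCast_iff] at *
  refine ((hv.mul_left 2).add (hw.mul_left 2)).of_nonneg_of_le (eig_term_nonneg ℓ m _) fun k => ?_
  have := mul_le_mul_of_nonneg_left (norm_sq_coeff_sub_le v w k)
    (pow_nonneg (eig_nonneg ℓ k) m)
  linarith

theorem normH_sub_sq_le {v w : L2 d} (hv : MemH ℓ m v) (hw : MemH ℓ m w) :
    normH ℓ m (v - w) ^ 2 ≤ 2 * normH ℓ m v ^ 2 + 2 * normH ℓ m w ^ 2 := by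
  have hvs := memH_natCast_iff.1 hv
  have hws := memH_natCast_iff.1 hw
  rw [normH_natCast_sq (hv.sub hw), normH_natCast_sq hv, normH_natCast_sq hw]
  have h1 : ∑' k, eig ℓ k ^ m * ‖coeff (v - w : L2 d) k‖ ^ 2 ≤
      2 * ∑' k, eig ℓ k ^ m * ‖coeff v k‖ ^ 2 + 2 * ∑' k, eig ℓ k ^ m * ‖coeff w k‖ ^ 2 := by
    rw [← tsum_mul_left, ← tsum_mul_left, ← (hvs.mul_left 2).tsum_add (hws.mul_left 2)]
    refine (memH_natCast_iff.1 (hv.sub hw)).tsum_le_tsum (fun k => ?_)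
      ((hvs.mul_left 2).add (hws.mul_left 2))
    have := mul_le_mul_of_nonneg_left (norm_sq_coeff_sub_le v w k)
      (pow_nonneg (eig_nonneg ℓ k) m)
    linarith
  have h2 := norm_sub_le v w
  nlinarith [norm_nonneg (v - w), sq_nonneg (‖v‖ - ‖w‖)]

theorem ContinuousInH.continuousOn {J : Set ℝ} {u : ℝ → L2 d} (h : ContinuousInH ℓ m J u) :
    ContinuousOn u J := by
  intro t ht
  rw [ContinuousWithinAt, tendsto_iff_norm_sub_tendsto_zero]
  refine squeeze_zero_norm' ?_ (h.2 t ht)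
  filter_upwards [self_mem_nhdsWithin] with r hr
  rw [norm_norm]
  exact norm_le_normH ((h.1 r hr).sub (h.1 t ht))

theorem ContinuousInH.exists_normH_le {S : ℝ} {u : ℝ → L2 d}
    (h : ContinuousInH ℓ m (Set.Icc 0 S) u) :
    ∃ B, ∀ t ∈ Set.Icc 0 S, normH ℓ m (u t) ≤ B := by
  refine isCompact_Icc.induction_on (p := fun s => ∃ B, ∀ t ∈ s, normH ℓ m (u t) ≤ B)
    ⟨0, fun t ht => ht.elim⟩ (fun s s' hss ⟨B, hB⟩ => ⟨B, fun t ht => hB t (hss ht)⟩)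
    (fun s s' ⟨B, hB⟩ ⟨B', hB'⟩ => ⟨max B B', fun t ht => ht.elim
      (fun ht => (hB t ht).trans (le_max_left _ _))
      fun ht => (hB' t ht).trans (le_max_right _ _)⟩) fun t ht => ?_
  have hev : ∀ᶠ r in 𝓝[Set.Icc 0 S] t, normH ℓ m (u r - u t) < 1 :=
    (h.2 t ht).eventually_lt_const one_pos
  have ht' := h.1 t ht
  have h0 : MemH ℓ m (0 : L2 d) := by simpa using ht'.sub ht'
  have hz : normH ℓ m (0 : L2 d) = 0 := by
    have : ∀ k, coeff (0 : L2 d) k = 0 := fun k => by rw [← fourierBasis_repr]; simp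
    simp only [normH, this]
    simp
  -- Two uses of `normH_sub_sq_le`, on `u r = (u r - u t) - (0 - u t)` and on `0 - u t`, replace the
  -- triangle inequality.
  refine ⟨_, inter_mem hev self_mem_nhdsWithin, √(2 + 4 * normH ℓ m (u t) ^ 2),
    fun r hr => Real.le_sqrt_of_sq_le ?_⟩
  have h1 := (h.1 r hr.2).sub ht'
  have h2 := normH_sub_sq_le h1 (h0.sub ht')
  have h3 := normH_sub_sq_le h0 ht'
  have h4 : normH ℓ m (u r - u t) ^ 2 ≤ 1 := pow_le_one₀ (normH_nonneg _ _ _) hr.1.le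
  rw [sub_sub_sub_cancel_right, sub_zero] at h2
  rw [hz] at h3
  linarith

/-! ### The equation as a truncated diagonal system. -/

/-- The symbol of the linear part of the equation. -/
def symb (P : Params) (ε : ℝ) (k : Fin P.d → ℤ) : ℂ :=
  Complex.I * (eig P.ℓ k : ℝ) - ((ε * P.μ * eig P.ℓ k ^ P.m : ℝ) : ℂ)

theorem symb_re (P : Params) (ε : ℝ) (k : Fin P.d → ℤ) :
    (symb P ε k).re = -(ε * P.μ * eig P.ℓ k ^ P.m) := by
  simp [symb, -Complex.ofReal_mul, -Complex.ofReal_pow]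

theorem symb_re_nonpos {P : Params} (hμ : 0 < P.μ) {ε : ℝ} (hε : 0 < ε) (k : Fin P.d → ℤ) :
    (symb P ε k).re ≤ 0 := by
  rw [symb_re]
  have := pow_nonneg (eig_nonneg P.ℓ k) P.m
  have : 0 ≤ ε * P.μ * eig P.ℓ k ^ P.m := by positivity
  linarith

/-- The truncated nonlinear part of the equation. -/
def nonlin (P : Params) (ε : ℝ) (R : ℝ≥0) (w : L2 P.d) : L2 P.d :=
  (ε : ℂ) • truncNL P.b P.c P.p P.q R w

theorem exists_lipschitzWith_nonlin (P : Params) (ε : ℝ) (R : ℝ≥0) :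
    ∃ K, LipschitzWith K (nonlin P ε R) := by
  obtain ⟨K, hK⟩ := exists_lipschitzWith_truncNL (d := P.d) P.b P.c P.p P.q R
  exact ⟨_, (lipschitzWith_smul (ε : ℂ)).comp hK⟩

theorem coeff_smul {d : ℕ} (z : ℂ) (w : L2 d) (k : Fin d → ℤ) :
    coeff (z • w : L2 d) k = z * coeff w k := by
  rw [← fourierBasis_repr, ← fourierBasis_repr, map_smul]
  rfl

theorem rhsCoeff_eq {P : Params} {R : ℝ≥0} {w : L2 P.d}
    (hw : ∀ᵐ y ∂torusMeasure P.d, ‖w y‖ ≤ R) (ε : ℝ) (k : Fin P.d → ℤ) :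
    rhsCoeff P ε w k = symb P ε k * coeff w k + coeff (nonlin P ε R w) k := by
  have hsign : (-1 : ℂ) ^ (P.m + 1) * ((-eig P.ℓ k : ℝ) : ℂ) ^ P.m = -(eig P.ℓ k : ℂ) ^ P.m := by
    rw [pow_succ, Complex.ofReal_neg, neg_pow (eig P.ℓ k : ℂ)]
    have : (-1 : ℂ) ^ P.m * (-1) ^ P.m = 1 := by rw [← mul_pow]; simp
    linear_combination (-(eig P.ℓ k : ℂ) ^ P.m) * this
  rw [nonlin, coeff_smul, coeff_truncNL hw, rhsCoeff, mul_assoc (P.μ : ℂ), hsign, symb]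
  push_cast
  ring

theorem solvesDiagonal_iff {P : Params} {ε S : ℝ} {R : ℝ≥0} {u : ℝ → L2 P.d}
    (hu : ∀ t ∈ Set.Icc 0 S, ∀ᵐ y ∂torusMeasure P.d, ‖u t y‖ ≤ R) :
    (fourierBasis P.d).SolvesDiagonal (symb P ε) (fun t => nonlin P ε R (u t)) u S ↔
      ∀ k : Fin P.d → ℤ, ∀ t ∈ Set.Icc 0 S,
        HasDerivWithinAt (fun r => coeff (u r) k) (rhsCoeff P ε (u t) k) (Set.Icc 0 S) t := by
  simp only [HilbertBasis.SolvesDiagonal, fourierBasis_repr]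
  refine forall_congr' fun k => forall₂_congr fun t ht => ?_
  rw [rhsCoeff_eq (hu t ht)]

/-! ### A priori estimates uniform in `ε`. -/

section Regularity

variable {P : Params} {ε S : ℝ} {R : ℝ≥0} {u : ℝ → L2 P.d}

theorem norm_le_of_solvesDiagonal (hμ : 0 < P.μ) (hb : P.b ≤ 0) (hε : 0 < ε)
    (hu : Continuous u)
    (h : (fourierBasis P.d).SolvesDiagonal (symb P ε) (fun t => nonlin P ε R (u t)) u S)
    {t : ℝ} (ht : t ∈ Set.Icc 0 S) : ‖u t‖ ≤ ‖u 0‖ := by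
  obtain ⟨K, hK⟩ := exists_lipschitzWith_nonlin P ε R
  have h1 := h.norm_sq_le (symb_re_nonpos hμ hε) hu.continuousOn
    (hK.continuous.comp hu).continuousOn ht
  have h2 : ∫ r in (0 : ℝ)..t, 2 * (inner ℂ (u r) (nonlin P ε R (u r))).re ≤ 0 := by
    rw [intervalIntegral.integral_of_le ht.1]
    refine integral_nonpos fun r => ?_
    have := re_inner_truncNL_nonpos hb P.c P.p P.q R (u r)
    simp only [nonlin, inner_smul_right, Complex.re_ofReal_mul, Pi.zero_apply]
    nlinarith
  exact le_of_sq_le_sq (by linarith) (norm_nonneg _)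

/-- Parabolic regularity with constants that do not depend on `ε`, as long as `ε S ≤ 1`. -/
theorem exists_majorant (hμ : 0 < P.μ) (hε : 0 < ε) (hS : 0 ≤ S) (hεS : ε * S ≤ 1)
    (hu : Continuous u)
    (h : (fourierBasis P.d).SolvesDiagonal (symb P ε) (fun t => nonlin P ε R (u t)) u S)
    (h0 : MemH P.ℓ P.m (u 0)) {M : ℝ}
    (hM : ∀ t ∈ Set.Icc 0 S, ‖truncNL P.b P.c P.p P.q R (u t)‖ ≤ M) :
    ∃ B : (Fin P.d → ℤ) → ℝ, Summable B ∧
      (∑' k, B k ≤ ∑' k, eig P.ℓ k ^ P.m * ‖coeff (u 0) k‖ ^ 2 + (2 * P.μ)⁻¹ * M ^ 2) ∧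
      ∀ t ∈ Set.Icc 0 S, ∀ k, eig P.ℓ k ^ P.m * ‖coeff (u t) k‖ ^ 2 ≤ B k := by
  obtain ⟨K, hK⟩ := exists_lipschitzWith_truncNL (d := P.d) P.b P.c P.p P.q R
  set N : ℝ → L2 P.d := fun t => truncNL P.b P.c P.p P.q R (u t) with hN
  have hNc : Continuous N := hK.continuous.comp hu
  -- The forcing `ε N` enters squared and is divided by `ε μ`; the one remaining `ε` pairs with the
  -- length `S` of the time interval.
  set J : (Fin P.d → ℤ) → ℝ := fun k =>
    (2 * P.μ)⁻¹ * ε * ∫ r in (0 : ℝ)..S, ‖(fourierBasis P.d).repr (N r) k‖ ^ 2 with hJ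
  have hJ0 : ∀ k, 0 ≤ J k := fun k => mul_nonneg (by positivity)
    (intervalIntegral.integral_nonneg hS fun r _ => sq_nonneg _)
  have hJsum : ∀ F : Finset (Fin P.d → ℤ), ∑ k ∈ F, J k ≤ (2 * P.μ)⁻¹ * M ^ 2 := by
    intro F
    rw [← Finset.mul_sum]
    have h1 := (fourierBasis P.d).sum_integral_norm_sq_repr_le hS hNc.continuousOn hM F
    calc _ ≤ (2 * P.μ)⁻¹ * ε * (S * M ^ 2) := by gcongr
      _ = (2 * P.μ)⁻¹ * M ^ 2 * (ε * S) := by ring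
      _ ≤ _ := mul_le_of_le_one_right (by positivity) hεS
  have hJs : Summable J := summable_of_sum_le hJ0 hJsum
  have h0s := memH_natCast_iff.1 h0
  refine ⟨_, h0s.add hJs, ?_, fun t ht k => ?_⟩
  · rw [h0s.tsum_add hJs]
    exact add_le_add_right (hJs.tsum_le_of_sum_le hJsum) _
  · have h1 := h.mul_norm_sq_repr_le (ν := fun k => ε * P.μ * eig P.ℓ k ^ P.m)
      (fun k => mul_nonneg (by positivity) (pow_nonneg (eig_nonneg P.ℓ k) _))
      (symb_re P ε) (hNc.const_smul (ε : ℂ)).continuousOn ht k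
    have h2 : ∀ r, ‖(fourierBasis P.d).repr (nonlin P ε R (u r)) k‖ ^ 2 =
        ε ^ 2 * ‖(fourierBasis P.d).repr (N r) k‖ ^ 2 := fun r => by
      rw [fourierBasis_repr, fourierBasis_repr, nonlin, coeff_smul, norm_mul, mul_pow, Complex.norm_real,
        Real.norm_eq_abs, sq_abs]
    simp only [h2, intervalIntegral.integral_const_mul] at h1
    rw [fourierBasis_repr, fourierBasis_repr] at h1
    have hpos : 0 < ε * P.μ := by positivity
    refine le_of_mul_le_mul_left ?_ hpos
    have h3 : ε * P.μ * J k =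
        2⁻¹ * (ε ^ 2 * ∫ r in (0 : ℝ)..S, ‖(fourierBasis P.d).repr (N r) k‖ ^ 2) := by
      simp only [hJ]
      field_simp
    rw [mul_add, h3]
    linarith

/-- A majorant independent of time upgrades `L²` continuity to `H^m` continuity by dominated
convergence. -/
theorem continuousInH_of_majorant {d m : ℕ} {ℓ : ℝ} {J : Set ℝ} {u : ℝ → L2 d}
    (hu : Continuous u) {B : (Fin d → ℤ) → ℝ} (hB : Summable B)
    (h : ∀ t ∈ J, ∀ k, eig ℓ k ^ m * ‖coeff (u t) k‖ ^ 2 ≤ B k) : ContinuousInH ℓ m J u := by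
  have hmem : ∀ t ∈ J, MemH ℓ m (u t) := fun t ht =>
    memH_natCast_iff.2 (hB.of_nonneg_of_le (eig_term_nonneg ℓ m _) (h t ht))
  refine ⟨hmem, fun t ht => ?_⟩
  have hdiff : Continuous fun r => u r - u t := hu.sub continuous_const
  have h1 : Tendsto (fun r => ∑' k, eig ℓ k ^ m * ‖coeff (u r - u t : L2 d) k‖ ^ 2) (𝓝[J] t)
      (𝓝 (∑' _ : Fin d → ℤ, (0 : ℝ))) := by
    refine tendsto_tsum_of_dominated_convergence (bound := fun k => 4 * B k) (hB.mul_left 4)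
      (fun k => ?_) ?_
    · have hc : Continuous fun r => eig ℓ k ^ m * ‖coeff (u r - u t : L2 d) k‖ ^ 2 := by
        simp only [← fourierBasis_repr]
        exact ((((fourierBasis d).coordCLM k).continuous.comp hdiff).norm.pow 2).const_mul _
      have h2 := hc.tendsto t
      rw [coeff_sub, sub_self] at h2
      simp only [norm_zero, ne_eq, OfNat.ofNat_ne_zero, not_false_eq_true, zero_pow,
        mul_zero] at h2
      exact h2.mono_left nhdsWithin_le_nhds
    · filter_upwards [self_mem_nhdsWithin] with r hr k
      rw [Real.norm_of_nonneg (eig_term_nonneg ℓ m _ k)]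
      have h2 := mul_le_mul_of_nonneg_left (norm_sq_coeff_sub_le (u r) (u t) k)
        (pow_nonneg (eig_nonneg ℓ k) m)
      have h3 := h r hr k
      have h4 := h t ht k
      linarith
  have h2 : Tendsto (fun r => ‖u r - u t‖ ^ 2) (𝓝[J] t) (𝓝 0) := by
    have hc : Continuous fun r => ‖u r - u t‖ ^ 2 := hdiff.norm.pow 2
    simpa using (hc.tendsto t).mono_left (nhdsWithin_le_nhds (s := J))
  have h3 := (h1.add h2).sqrt
  rw [tsum_zero, add_zero, Real.sqrt_zero] at h3
  refine h3.congr' ?_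
  filter_upwards [self_mem_nhdsWithin] with r hr
  rw [← normH_natCast_sq ((hmem r hr).sub (hmem t ht)), Real.sqrt_sq (normH_nonneg _ _ _)]

end Regularity

/-! ### Uniqueness, removal of the truncation, and conclusion. -/

theorem IsSolution.eqOn {P : Params} (hμ : 0 < P.μ) (hℓ : 0 < P.ℓ) {L : ℕ} (hL : L ≠ 0)
    (hm : P.m = 2 * L * (P.d + 1)) {ε S : ℝ} (hε : 0 < ε) {u₀ : L2 P.d} {u v : ℝ → L2 P.d}
    (hu : IsSolution P ε P.m S u₀ u) (hv : IsSolution P ε P.m S u₀ v) :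
    Set.EqOn v u (Set.Icc 0 S) := by
  have hbd : ∀ w : ℝ → L2 P.d, IsSolution P ε P.m S u₀ w → ∃ A : ℝ≥0, ∀ t ∈ Set.Icc 0 S,
      ∀ᵐ y ∂torusMeasure P.d, ‖w t y‖ ≤ A := by
    intro w hw
    obtain ⟨B, hB⟩ := hw.continuousInH.exists_normH_le
    refine ⟨(B * ∑' k, weight (d := P.d) P.ℓ k).toNNReal, fun t ht => ?_⟩
    have hmem := hw.continuousInH.1 t ht
    have hBt := hB t ht
    have hB0 : 0 ≤ B := (normH_nonneg _ _ _).trans hBt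
    have hk : ∀ k, ‖coeff (w t) k‖ ≤ B * weight P.ℓ k := fun k => ?_
    · exact (ae_norm_le_of_coeff_le hℓ hk).mono fun y hy => hy.trans (Real.le_coe_toNNReal _)
    · refine le_mul_weight hL hB0 ?_
      rw [← hm]
      have h1 := mul_norm_sq_coeff_le hmem k
      have h2 : ‖coeff (w t) k‖ ≤ B := by
        rw [← fourierBasis_repr]
        exact ((fourierBasis P.d).norm_repr_le _ _).trans ((norm_le_normH hmem).trans hBt)
      have h3 : normH P.ℓ P.m (w t) ^ 2 ≤ B ^ 2 := pow_le_pow_left₀ (normH_nonneg _ _ _) hBt 2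
      -- Of the `2L` factors, two are controlled by the `H^m` norm and the rest by the `L²` norm.
      have h4 : ‖coeff (w t) k‖ ^ (2 * (L - 1)) ≤ B ^ (2 * (L - 1)) :=
        pow_le_pow_left₀ (norm_nonneg _) h2 _
      have h5 : 2 * L = 2 * (L - 1) + 2 := by omega
      rw [h5, pow_add, pow_add, mul_assoc]
      refine mul_le_mul h4 (by linarith) ?_ (by positivity)
      have := pow_nonneg (eig_nonneg P.ℓ k) P.m
      positivity
  obtain ⟨A, hA⟩ := hbd u hu
  obtain ⟨A', hA'⟩ := hbd v hv
  -- At this common level neither solution is affected by the truncation.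
  obtain ⟨K, hK⟩ := exists_lipschitzWith_nonlin P ε (max A A')
  refine HilbertBasis.SolvesDiagonal.eqOn (e := fourierBasis P.d) hK (symb_re_nonpos hμ hε)
    ((solvesDiagonal_iff fun t ht => (hA' t ht).mono fun y hy => ?_).2 hv.equation)
    hv.continuousInH.continuousOn
    ((solvesDiagonal_iff fun t ht => (hA t ht).mono fun y hy => ?_).2 hu.equation)
    hu.continuousInH.continuousOn (hv.initial.trans hu.initial.symm)
  · exact hy.trans (NNReal.coe_le_coe.2 (le_max_right _ _))
  · exact hy.trans (NNReal.coe_le_coe.2 (le_max_left _ _))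

/-- The Sobolev bound at time of order `ε⁻¹`: `κ` measures the nonlinearity relative to the
dissipation, `n` its degree, and `W` is the constant of the embedding into bounded functions. -/
def sobolevBound (κ W : ℝ) (n : ℕ) (x : ℝ) : ℝ :=
  √(x ^ 2 * (1 + κ) * (1 + x * (1 + κ) * W) ^ (8 * n))

theorem exists_isSolution {P : Params} (hμ : 0 < P.μ) (hb : P.b ≤ 0) (hℓ : 0 < P.ℓ)
    (hm : P.m = 2 * (4 * (P.p + P.q) + 1) * (P.d + 1)) {ε S : ℝ} (hε : 0 < ε) (hS : 0 ≤ S)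
    (hεS : ε * S ≤ 1) {u₀ : L2 P.d} (h0 : MemH P.ℓ P.m u₀) :
    ∃ u, IsSolution P ε P.m S u₀ u ∧ ∀ t ∈ Set.Icc 0 S, normH P.ℓ P.m (u t) ≤
      sobolevBound ((|P.b| + |P.c|) ^ 2 / (2 * P.μ)) (∑' k, weight (d := P.d) P.ℓ k)
        (P.p + P.q) (normH P.ℓ P.m u₀) := by
  set κ : ℝ := (|P.b| + |P.c|) ^ 2 / (2 * P.μ) with hκ
  set W : ℝ := ∑' k, weight (d := P.d) P.ℓ k
  set n := P.p + P.q
  set ρ := normH P.ℓ P.m u₀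
  have hκ0 : 0 ≤ κ := by positivity
  have hW0 : 0 ≤ W := tsum_nonneg (weight_nonneg P.ℓ)
  have hρ0 : 0 ≤ ρ := normH_nonneg _ _ _
  set Q : ℝ := 1 + ρ * (1 + κ) * W with hQ
  have hQ1 : 1 ≤ Q := le_add_of_nonneg_right (by positivity)
  have hQ0 : 0 ≤ Q := zero_le_one.trans hQ1
  -- The sup bound obtained below is `ρ(1+κ)W Q`, and `ρ(1+κ)W = Q - 1`, so the level `Q²` is not
  -- exceeded.
  set R : ℝ≥0 := ⟨Q ^ 2, by positivity⟩
  have hRQ : (R : ℝ) = Q ^ 2 := rfl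
  have hR1 : 1 ≤ R := by
    rw [← NNReal.coe_le_coe, hRQ]
    exact one_le_pow₀ hQ1
  obtain ⟨K, hK⟩ := exists_lipschitzWith_nonlin P ε R
  obtain ⟨u, hu, hu0, hsol⟩ := (fourierBasis P.d).exists_solvesDiagonal (symb_re_nonpos hμ hε) hK
    (by simp [nonlin, truncNL_zero]) u₀
  specialize hsol S
  have hρ : ‖u₀‖ ≤ ρ := norm_le_normH h0
  have hL2 : ∀ t ∈ Set.Icc 0 S, ‖u t‖ ≤ ρ := fun t ht =>
    (norm_le_of_solvesDiagonal hμ hb hε hu hsol ht).trans (by rwa [hu0])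
  have hM : ∀ t ∈ Set.Icc 0 S, ‖truncNL P.b P.c P.p P.q R (u t)‖ ≤
      (|P.b| + |P.c|) * R ^ (2 * n) * ρ := fun t ht =>
    (norm_truncNL_le _ _ _ _ hR1 _).trans
      (mul_le_mul_of_nonneg_left (hL2 t ht) (by positivity))
  obtain ⟨B, hBs, hBle, hB⟩ := exists_majorant hμ hε hS hεS hu hsol (by rwa [hu0]) hM
  have hcont : ContinuousInH P.ℓ P.m (Set.Icc 0 S) u := continuousInH_of_majorant hu hBs hB
  set Y := ρ ^ 2 * (1 + κ) * Q ^ (8 * n) with hY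
  have hnorm : ∀ t ∈ Set.Icc 0 S, normH P.ℓ P.m (u t) ^ 2 ≤ Y := by
    intro t ht
    have h1 := normH_natCast_sq (hcont.1 t ht)
    have h2 := (memH_natCast_iff.1 (hcont.1 t ht)).tsum_le_tsum (hB t ht) hBs
    have h3 := normH_natCast_sq h0
    have h4 : ‖u t‖ ^ 2 ≤ ‖u₀‖ ^ 2 := by
      rw [← hu0]
      exact pow_le_pow_left₀ (norm_nonneg _) (norm_le_of_solvesDiagonal hμ hb hε hu hsol ht) 2
    have h5 : (2 * P.μ)⁻¹ * ((|P.b| + |P.c|) * R ^ (2 * n) * ρ) ^ 2 =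
        κ * ρ ^ 2 * Q ^ (8 * n) := by
      rw [hRQ, hκ, mul_pow, mul_pow, ← pow_mul, ← pow_mul, show 2 * (2 * n * 2) = 8 * n by omega]
      ring
    have h6 : ρ ^ 2 ≤ ρ ^ 2 * Q ^ (8 * n) := le_mul_of_one_le_right (sq_nonneg _) (one_le_pow₀ hQ1)
    rw [hu0, h5] at hBle
    have h7 : Y = ρ ^ 2 * Q ^ (8 * n) + κ * ρ ^ 2 * Q ^ (8 * n) := by rw [hY]; ring
    change ρ ^ 2 = _ at h3
    linarith
  have hsup : ∀ t ∈ Set.Icc 0 S, ∀ᵐ y ∂torusMeasure P.d, ‖u t y‖ ≤ R := by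
    intro t ht
    have hk : ∀ k, ‖coeff (u t) k‖ ≤ ρ * (1 + κ) * Q * weight P.ℓ k := fun k => ?_
    · refine (ae_norm_le_of_coeff_le hℓ hk).mono fun y hy => hy.trans ?_
      rw [hRQ]
      change ρ * (1 + κ) * Q * W ≤ Q ^ 2
      nlinarith
    · refine le_mul_weight (L := 4 * n + 1) (by omega) (by positivity) ?_
      rw [← hm]
      have h1 := (mul_norm_sq_coeff_le (hcont.1 t ht) k).trans (hnorm t ht)
      have h2 : ‖coeff (u t) k‖ ≤ ρ := by
        rw [← fourierBasis_repr]
        exact ((fourierBasis P.d).norm_repr_le _ _).trans (hL2 t ht)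
      have h3 := pow_nonneg (eig_nonneg P.ℓ k) P.m
      have hκ1 : 1 ≤ 1 + κ := le_add_of_nonneg_right hκ0
      calc ‖coeff (u t) k‖ ^ (2 * (4 * n + 1)) * (eig P.ℓ k ^ P.m + 1)
          = ‖coeff (u t) k‖ ^ (8 * n) * ((eig P.ℓ k ^ P.m + 1) * ‖coeff (u t) k‖ ^ 2) := by ring
        _ ≤ ρ ^ (8 * n) * Y := mul_le_mul (pow_le_pow_left₀ (norm_nonneg _) h2 _) h1
            (by positivity) (by positivity)
        _ = ρ ^ (8 * n + 2) * (1 + κ) ^ 1 * Q ^ (8 * n) := by rw [hY]; ring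
        -- Since `1 + κ` and `Q` are at least `1`, their exponents can be raised to produce a
        -- perfect power.
        _ ≤ ρ ^ (8 * n + 2) * (1 + κ) ^ (8 * n + 2) * Q ^ (8 * n + 2) := by
            gcongr
            · omega
            · omega
        _ = (ρ * (1 + κ) * Q) ^ (2 * (4 * n + 1)) := by
            rw [mul_pow, mul_pow, show 2 * (4 * n + 1) = 8 * n + 2 by omega]
  exact ⟨u, ⟨hcont, hu0, (solvesDiagonal_iff hsup).1 hsol⟩,
    fun t ht => Real.le_sqrt_of_sq_le (hnorm t ht)⟩

theorem uniformlyWellPosed {P : Params} (hμ : 0 < P.μ) (hb : P.b ≤ 0) (hℓ : 0 < P.ℓ)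
    (hm : P.m = 2 * (4 * (P.p + P.q) + 1) * (P.d + 1)) : UniformlyWellPosed P := by
  set κ : ℝ := (|P.b| + |P.c|) ^ 2 / (2 * P.μ) with hκ
  set W : ℝ := ∑' k, weight (d := P.d) P.ℓ k
  have hκ0 : 0 ≤ κ := by positivity
  have hW0 : 0 ≤ W := tsum_nonneg (weight_nonneg P.ℓ)
  -- `max x 0` makes the bound monotone on all of `ℝ`; norms are nonnegative, so it changes nothing
  -- there.
  refine ⟨P.m, ?_, 1, one_pos, fun x => sobolevBound κ W (P.p + P.q) (max x 0), ?_, ?_⟩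
  · have h1 : (P.d : ℝ) < P.m := by
      have : P.d < P.m := by
        rw [hm]
        nlinarith [Nat.zero_le (P.d * (P.p + P.q)), Nat.zero_le (P.p + P.q)]
      exact_mod_cast this
    have : (0 : ℝ) ≤ P.d := Nat.cast_nonneg _
    linarith
  · intro x y hxy
    have h0 : 0 ≤ max x 0 := le_max_right _ _
    have h1 : max x 0 ≤ max y 0 := max_le_max_right 0 hxy
    simp only [sobolevBound]
    gcongr
  · intro ε hε u₀ h0
    obtain ⟨u, hu, hbound⟩ := exists_isSolution hμ hb hℓ hm hε (S := ε⁻¹ * 1) (by positivity)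
      (by rw [mul_one, mul_inv_cancel₀ hε.ne']) h0
    refine ⟨u, hu, fun v hv => hu.eqOn hμ hℓ (by omega) hm hε hv, fun t ht => ?_⟩
    simp only [max_eq_left (normH_nonneg P.ℓ P.m u₀)]
    exact hbound t ht

end CGL

end

theorem proposition1 (ℓ : ℝ) (hℓ : 0 < ℓ) (μ b c : ℝ) (hμ : 0 < μ) (hb : b ≤ 0) (hc : c ≤ 0)
    (p q d : ℕ) :
    ∃ m : ℕ, 1 ≤ m ∧
      CGL.UniformlyWellPosed { d := d, ℓ := ℓ, m := m, p := p, q := q, μ := μ, b := b, c := c } :=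
  ⟨2 * (4 * (p + q) + 1) * (d + 1), Nat.succ_le_of_lt (by positivity),
    CGL.uniformlyWellPosed hμ hb hℓ rfl⟩
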